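/- \textbf{Setting.} Let $\theta\in(0,1)$ be irrational and let $c_0,c_1,\dots$ be the positive integers with $\theta=\cfrac{1}{c_0+\cfrac{1}{c_1+\cdots}}$. Put $\theta_0=\theta$ and $\theta_{n+1}=1/\theta_n-\lfloor 1/\theta_n\rfloor$. Let $D_\infty$ be the infinite dihedral group generated by the involutions $a,b$. It acts from the right on the circle $\mathbb R/\mathbb Z$ by $x\cdot a=1-x$, $x\cdot b=\theta-x$. Let $\mathcal X_\theta$ be the Cantor set obtained from the circle by replacing each point $x$ of the orbit of $0$ by two points $x-0,\,x+0$ (so that $1=0-0$, $0=0+0$), with its order topology on $[0,1]=[0+0,1-0]$. The action lifts to $\mathcal X_\theta$ by $(x\mp0)\cdot g=x\cdot g\pm0$ for $g\in\{a,b\}$. For orbit points $x<y$ write $[x,y]$ for the clopen interval $[x+0,y-0]$. \textbf{Towers.} A \emph{Rokhlin--Kakutani (RK) set} here is a finite family of towers. Each tower is given by a clopen base and a finite set of elements $g\in D_\infty$ containing $1$, with each element reachable from $1$ inside the set by right multiplication by $a,b$; the tower is the collection of the sets $\text{base}\cdot g$, which are nonempty clopen intervals. All the sets of all the towers together partition $\mathcal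 X_\theta$. Define $\mathcal A_0,\mathcal A_1,\dots$, each with two towers labelled $0,1$, as follows. For every irrational parameter $\theta$, $\mathcal A_0$ has the towers $\{[0,\theta]\}$ and $\{[\theta,1]\}$ (with element $1$). Let $\theta'=\theta_1$ and $r=\lfloor1/\theta\rfloor$. Then $\mathcal A_{n+1}$ on $\mathcal X_\theta$ is obtained from $\mathcal A_n$ on $\mathcal X_{\theta'}$ by transporting it into $[0,\theta]$ by the similarity $\sigma(y)=\theta y$: the bases are the sets $\sigma(\text{base})$, and the elements of a tower are the products $h\,w_k$. Here $h\in D_\infty$ satisfies $\sigma(y)\cdot h=\sigma(y\cdot g')$ for all $y$ in the base and some element $g'$ of the corresponding tower on $\mathcal X_{\theta'}$; $w_k=abab\cdots$ is the alternating word with $k$ letters starting with $a$; and $0\le k\le r$ if $\text{base}\cdot g'\subset[0,\theta']$, $0\le k\le r-1$ if $\text{base}\cdot g'\subset[\theta',1]$. (Thus $\mathcal A_1$ has the towers $\{I_0,I_0\cdot a,I_0\cdot ab,\dots\}$ with $r+1$ elements and $\{J_0,J_0\cdot a,J_0\cdot ab,\dots\}$ with $r$ elements, where $I_0=[0,1-r\theta]$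 and $J_0=[1-r\theta,\theta]$.) \textbf{Diagram.} The (unordered) Bratteli diagram $\mathsf B$ of $(\mathcal A_n)_{n\ge0}$ has the towers of $\mathcal A_n$ as the vertices $V_n$ of level $n$. The edges from $u\in V_{n-1}$ to $v\in V_n$ are the elements of the tower $v$ of $\mathcal A_n$ contained in the base of the tower $u$ of $\mathcal A_{n-1}$; $E_n$ is the set of all edges from level $n-1$ to level $n$. Let $\Omega(\mathsf B)$ be the space of infinite paths $\dots e_2e_1$ starting in $V_0$, with the topology induced from $\prod_n E_n$. If $e_k$ corresponds to the tower element $\text{base}\cdot g_k$, put $g(e_n\cdots e_1)=g_n\cdots g_1$. A right action of $D_\infty$ on $\Omega(\mathsf B)$ by homeomorphisms is called \emph{natural} if \[(\dots e_{n+2}e_{n+1}\,\gamma_n)\cdot\big(g(\gamma_n)^{-1}g(\gamma_n')\big)=\dots e_{n+2}e_{n+1}\,\gamma_n'\] for all $n$, all finite paths $\gamma_n,\gamma_n'$ of length $n$ with the same end vertex, and all continuations $\dots e_{n+2}e_{n+1}$. \textbf{Theorem.} (1) Every $\mathcal A_n$ is an RK-set, and $\mathcal A_0\prec\mathcal A_1\prec\cdots$,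 i.e. the tower $v$ of $\mathcal A_{n+1}$ has as its group elements exactly the products $hg$, where $h$ is an element of the tower $v$ with $\text{base}\cdot h$ contained in the base of a tower $u$ of $\mathcal A_n$, and $g$ is an element of the tower $u$. (2) $\mathsf B$ is a Bratteli diagram (finite levels, surjective source and range maps) with $V_n=\{0,1\}$ for $n\ge0$, and for $n\ge1$: if $\theta_{n-1}<1/2$ (equivalently $c_{n-1}\ge2$), then $0\in V_{n-1}$ is connected to each of $0,1\in V_n$ by a single edge, and $1\in V_{n-1}$ is connected to $0\in V_n$ by $c_{n-1}$ edges and to $1\in V_n$ by $c_{n-1}-1$ edges; if $\theta_{n-1}>1/2$ (equivalently $c_{n-1}=1$), then $0\in V_{n-1}$ is connected to each of $0,1\in V_n$ by a single edge, and $1\in V_{n-1}$ is connected to $0\in V_n$ by a single edge and is not connected to $1\in V_n$. (3) There is exactly one natural action of $D_\infty$ on $\Omega(\mathsf B)$, and it is topologically conjugate to the action of $D_\infty$ on $\mathcal X_\theta$: there is a homeomorphism $\Phi:\Omega(\mathsf B)\to\mathcal X_\theta$ with $\Phi(\gamma\cdot g)=\Phi(\gamma)\cdot g$ for all $\gamma\in\Omega(\mathsf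 B)$, $g\in D_\infty$. Moreover $\Phi$ can be chosen so that, for every path $\gamma=\dots e_2e_1$ and every $n\ge1$, $\Phi(\gamma)$ lies in the clopen set $\text{base}\cdot g(e_n\cdots e_1)$ of $\mathcal A_n$, where the base is that of the tower at the end of $e_n$. -/

import Mathlib

open Set Filter Topology MulOpposite

/-! ### Irrational parameters, the Gauss map, continued fractions -/

/-- Irrational numbers in `(0, 1)`. -/
abbrev IrrUnit : Type := {θ : ℝ // Irrational θ ∧ 0 < θ ∧ θ < 1}

/-- The first digit `⌊1/θ⌋` of the continued fraction of `θ`. -/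
noncomputable def cfDigit (θ : IrrUnit) : ℕ := ⌊1 / θ.1⌋₊

/-- `θ ↦ θ' = 1/θ - ⌊1/θ⌋`, so that `θ = 1 / (⌊1/θ⌋ + θ')`. -/
noncomputable def gauss (θ : IrrUnit) : IrrUnit :=
  ⟨1 / θ.1 - (cfDigit θ : ℝ), by
    obtain ⟨x, hx, h0, h1⟩ := θ
    have hi : Irrational (1 / x - ((⌊1 / x⌋₊ : ℕ) : ℝ)) := by
      have := hx.inv.sub_natCast ⌊1 / x⌋₊
      simpa [one_div] using this
    have hle : ((⌊1 / x⌋₊ : ℕ) : ℝ) ≤ 1 / x := Nat.floor_le (by positivity)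
    have hlt : 1 / x < ((⌊1 / x⌋₊ : ℕ) : ℝ) + 1 := Nat.lt_floor_add_one _
    refine ⟨hi, ?_, ?_⟩
    · exact lt_of_le_of_ne (sub_nonneg.mpr hle) (fun h => hi.ne_zero h.symm)
    · show 1 / x - ((⌊1 / x⌋₊ : ℕ) : ℝ) < 1
      linarith⟩

/-- `θ_n`: the `n`-th iterate, i.e. `θ_0 = θ` and `θ_n = 1 / (⌊1/θ_n⌋ + θ_{n+1})`. -/
noncomputable def thetaSeq (θ : IrrUnit) (n : ℕ) : ℝ := (gauss^[n] θ).1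

/-- The finite continued fraction `1 / (c_0 + 1 / (c_1 + ... + 1 / c_{n-1}))`. -/
noncomputable def finCF : (ℕ → ℕ) → ℕ → ℝ
  | _, 0 => 0
  | c, n + 1 => 1 / ((c 0 : ℝ) + finCF (fun k => c (k + 1)) n)

/-! ### The infinite dihedral group -/

/-- The infinite dihedral group. -/
abbrev DInf : Type := DihedralGroup 0

/-- The generator `a`. -/
def genA : DInf := DihedralGroup.sr 0

/-- The generator `b`; thus `a * b` is the generator `r 1` of the rotation subgroup. -/
def genB : DInf := DihedralGroup.sr 1

/-- The alternating word `abab...` with `k` letters, starting with `a`. -/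
def altWord : ℕ → DInf
  | 0 => 1
  | k + 1 => altWord k * (if Even k then genA else genB)

/-- The right action of the infinite dihedral group defined by two involutions:
`op g • x` is the point `x · g`, with `x · a = α x` and `x · b = β x`. -/
@[reducible] def dihedralRightAction {X : Type*} (α β : X → X)
    (hα : Function.Involutive α) (hβ : Function.Involutive β) : MulAction DInfᵐᵒᵖ X :=
  let A : Equiv.Perm X := hα.toPerm α
  let B : Equiv.Perm X := hβ.toPerm β
  let P : ℤ → Equiv.Perm X := fun i => (B * A) ^ i
  { smul := fun g x => match unop g with
      | DihedralGroup.r i => P i x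
      | DihedralGroup.sr i => P i (A x)
    one_smul := fun x => by
      show P 0 x = x
      simp [P]
    mul_smul := fun g h x => by
      have hA : A * A = 1 := by ext y; exact hα y
      have hB : B * B = 1 := by ext y; exact hβ y
      have hAi : A⁻¹ = A := inv_eq_of_mul_eq_one_left hA
      have hBi : B⁻¹ = B := inv_eq_of_mul_eq_one_left hB
      have hP : ∀ i j : ℤ, P (i + j) = P i * P j := fun i j => zpow_add _ i j
      have key : ∀ i : ℤ, A * P i = P (-i) * A := by
        intro i
        have h1 : A * (B * A) * A⁻¹ = (B * A)⁻¹ := by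
          rw [mul_inv_rev, hAi, hBi, mul_assoc, mul_assoc, hA, mul_one]
        have h2 : A * P i * A⁻¹ = P (-i) := by
          show A * (B * A) ^ i * A⁻¹ = (B * A) ^ (-i)
          rw [← conj_zpow, h1, inv_zpow']
        rw [← h2, inv_mul_cancel_right]
      have key' : ∀ (i : ℤ) (y : X), A (P i y) = P (-i) (A y) := fun i y =>
        congrArg (fun f : Equiv.Perm X => f y) (key i)
      have hP' : ∀ (i j : ℤ) (y : X), P (i + j) y = P i (P j y) := fun i j y =>
        congrArg (fun f : Equiv.Perm X => f y) (hP i j)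
      induction g using MulOpposite.rec' with
      | _ g =>
      induction h using MulOpposite.rec' with
      | _ h =>
      rcases g with i | i <;> rcases h with j | j <;> change ℤ at i j
      · show P (j + i) x = P i (P j x)
        rw [add_comm, hP']
      · show P (j + i) (A x) = P i (P j (A x))
        rw [add_comm, hP']
      · show P (i - j) (A x) = P i (A (P j x))
        rw [key', sub_eq_add_neg, hP']
      · show P (i - j) x = P i (A (P j (A x)))
        rw [key', sub_eq_add_neg, hP', show A (A x) = x from hα x] }

/-! ### The Cantor set obtained by cutting the circle along the orbit of `0` -/

/-- The lift to `ℝ` of the orbit of `0 ∈ ℝ/ℤ` under the rotation by `θ`. -/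
def cutSet (θ : ℝ) : Set ℝ := {x | ∃ m n : ℤ, x = m + n * θ}

/-- The circle `ℝ/ℤ` in which each point `x` of the orbit of `0` is replaced by two points
`x - 0` and `x + 0`.  A point is a pair `(x, s)` with `x ∈ [0, 1]`, where `s = 0` if `x` is not
in the orbit and `s = ±1` encodes `x ± 0` if it is.  The point `0 + 0` is `(0, 1)`, and
`0 - 0 = 1 - 0` is `(1, -1)`. -/
def CutCircle (θ : IrrUnit) : Type :=
  {p : ℝ ×ₗ SignType //
    0 ≤ (ofLex p).1 ∧ (ofLex p).1 ≤ 1 ∧ ((ofLex p).2 = 0 ↔ (ofLex p).1 ∉ cutSet θ.1) ∧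
    ((ofLex p).1 = 0 → (ofLex p).2 = 1) ∧ ((ofLex p).1 = 1 → (ofLex p).2 = -1)}

namespace CutCircle

/-- The lexicographic order: `x - 0 < x + 0`. -/
noncomputable instance (θ : IrrUnit) : LinearOrder (CutCircle θ) :=
  inferInstanceAs (LinearOrder {_p : ℝ ×ₗ SignType // _})

noncomputable instance (θ : IrrUnit) : TopologicalSpace (CutCircle θ) := Preorder.topology _

instance (θ : IrrUnit) : OrderTopology (CutCircle θ) := ⟨rfl⟩

variable {θ : IrrUnit}

/-- The underlying number in `[0, 1]`. -/
def pos (p : CutCircle θ) : ℝ := (ofLex p.1).1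

/-- The side: `-1` for `x - 0`, `1` for `x + 0`, and `0` for a point that is not doubled. -/
def side (p : CutCircle θ) : SignType := (ofLex p.1).2

theorem ext' {p q : CutCircle θ} (h1 : p.pos = q.pos) (h2 : p.side = q.side) : p = q :=
  Subtype.ext (ofLex.injective (Prod.ext h1 h2))

/-- The point with given coordinates. -/
def mk (x : ℝ) (s : SignType) (h0 : 0 ≤ x) (h1 : x ≤ 1) (h : s = 0 ↔ x ∉ cutSet θ.1)
    (hz : x = 0 → s = 1) (ho : x = 1 → s = -1) : CutCircle θ :=
  ⟨toLex (x, s), h0, h1, h, hz, ho⟩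

theorem pos_nonneg (p : CutCircle θ) : 0 ≤ p.pos := p.2.1

theorem pos_le_one (p : CutCircle θ) : p.pos ≤ 1 := p.2.2.1

theorem side_eq_zero (p : CutCircle θ) : p.side = 0 ↔ p.pos ∉ cutSet θ.1 := p.2.2.2.1

theorem side_of_pos_zero (p : CutCircle θ) : p.pos = 0 → p.side = 1 := p.2.2.2.2.1

theorem side_of_pos_one (p : CutCircle θ) : p.pos = 1 → p.side = -1 := p.2.2.2.2.2

theorem sub_mem_cutSet (t : ℝ) (k l : ℤ) (x : ℝ) :
    (k + l * t) - x ∈ cutSet t ↔ x ∈ cutSet t := by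
  constructor
  · rintro ⟨m, n, h⟩
    refine ⟨k - m, l - n, ?_⟩
    push_cast
    linear_combination -h
  · rintro ⟨m, n, h⟩
    refine ⟨k - m, l - n, ?_⟩
    push_cast
    linear_combination -h

theorem neg_side_eq_zero (p : CutCircle θ) (y : ℝ) (k l : ℤ) (h : y = (k + l * θ.1) - p.pos) :
    -p.side = 0 ↔ y ∉ cutSet θ.1 := by
  rw [h, sub_mem_cutSet, ← p.side_eq_zero]
  cases p.side <;> decide

/-- `x · a = 1 - x`, interchanging the sides. -/
def flipA (p : CutCircle θ) : CutCircle θ :=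
  mk (1 - p.pos) (-p.side) (by linarith [p.pos_le_one]) (by linarith [p.pos_nonneg])
    (neg_side_eq_zero p _ 1 0 (by push_cast; ring))
    (fun h => by rw [p.side_of_pos_one (by linarith)]; rfl)
    (fun h => by rw [p.side_of_pos_zero (by linarith)])

/-- The point lies in `[0, θ] = [0 + 0, θ - 0]`. -/
def IsLow (p : CutCircle θ) : Prop := p.1 ≤ toLex (θ.1, (-1 : SignType))

theorem isLow_iff (p : CutCircle θ) :
    p.IsLow ↔ p.pos < θ.1 ∨ (p.pos = θ.1 ∧ p.side = -1) := by
  unfold IsLow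
  rw [Prod.Lex.le_iff]
  have : ∀ s : SignType, s ≤ -1 ↔ s = -1 := by decide
  exact or_congr Iff.rfl (and_congr Iff.rfl (this _))

theorem theta_mem_cutSet (t : ℝ) : t ∈ cutSet t := ⟨0, 1, by simp⟩

theorem side_of_not_isLow (p : CutCircle θ) (h : ¬ p.IsLow) (h' : p.pos = θ.1) :
    p.side = 1 := by
  rw [isLow_iff] at h
  have h0 : p.side ≠ 0 := fun h0 => (p.side_eq_zero.mp h0) (h' ▸ theta_mem_cutSet _)
  have h1 : p.side ≠ -1 := fun h1 => h (Or.inr ⟨h', h1⟩)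
  revert h0 h1
  cases p.side <;> decide

theorem le_pos_of_not_isLow (p : CutCircle θ) (h : ¬ p.IsLow) : θ.1 ≤ p.pos := by
  rw [isLow_iff] at h
  exact not_lt.mp fun h' => h (Or.inl h')

theorem pos_le_of_isLow (p : CutCircle θ) (h : p.IsLow) : p.pos ≤ θ.1 := by
  rw [isLow_iff] at h
  rcases h with h | h
  · exact h.le
  · exact h.1.le

open Classical in
/-- `x · b = θ - x` modulo `1`, interchanging the sides. -/
noncomputable def flipB (p : CutCircle θ) : CutCircle θ :=
  if h : p.IsLow then
    mk (θ.1 - p.pos) (-p.side) (by linarith [p.pos_le_of_isLow h])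
      (by linarith [p.pos_nonneg, θ.2.2.2])
      (neg_side_eq_zero p _ 0 1 (by push_cast; ring))
      (fun h' => by
        have h2 := p.isLow_iff.mp h
        rcases h2 with h2 | h2
        · linarith
        · rw [h2.2]; rfl)
      (fun h' => by linarith [p.pos_nonneg, θ.2.2.2])
  else
    mk (1 + θ.1 - p.pos) (-p.side) (by linarith [p.pos_le_one, θ.2.2.1])
      (by linarith [p.le_pos_of_not_isLow h])
      (neg_side_eq_zero p _ 1 1 (by push_cast; ring))
      (fun h' => by linarith [p.pos_le_one, θ.2.2.1])
      (fun h' => by rw [p.side_of_not_isLow h (by linarith)])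

theorem flipA_involutive : Function.Involutive (flipA (θ := θ)) := by
  intro p
  refine ext' ?_ ?_
  · show 1 - (1 - p.pos) = p.pos
    ring
  · show - -p.side = p.side
    exact neg_neg _

theorem flipB_of_isLow {p : CutCircle θ} (h : p.IsLow) :
    p.flipB.pos = θ.1 - p.pos ∧ p.flipB.side = -p.side := by
  unfold flipB
  rw [dif_pos h]
  exact ⟨rfl, rfl⟩

theorem flipB_of_not_isLow {p : CutCircle θ} (h : ¬ p.IsLow) :
    p.flipB.pos = 1 + θ.1 - p.pos ∧ p.flipB.side = -p.side := by
  unfold flipB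
  rw [dif_neg h]
  exact ⟨rfl, rfl⟩

theorem flipB_involutive : Function.Involutive (flipB (θ := θ)) := by
  intro p
  by_cases h : p.IsLow
  · obtain ⟨h1, h2⟩ := flipB_of_isLow h
    have h3 : p.flipB.IsLow := by
      rw [isLow_iff, h1, h2]
      rcases p.pos_nonneg.lt_or_eq with h0 | h0
      · left; linarith
      · right; exact ⟨by linarith, by rw [p.side_of_pos_zero h0.symm]⟩
    obtain ⟨h4, h5⟩ := flipB_of_isLow h3
    exact ext' (by rw [h4, h1]; ring) (by rw [h5, h2, neg_neg])
  · obtain ⟨h1, h2⟩ := flipB_of_not_isLow h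
    have h3 : ¬ p.flipB.IsLow := by
      rw [isLow_iff, h1, h2]
      rintro (h0 | ⟨h0, h0'⟩)
      · linarith [p.pos_le_one]
      · rw [p.side_of_pos_one (by linarith)] at h0'
        exact absurd h0' (by decide)
    obtain ⟨h4, h5⟩ := flipB_of_not_isLow h3
    exact ext' (by rw [h4, h1]; ring) (by rw [h5, h2, neg_neg])

/-- The right action of the dihedral group on the cut circle: `op g • x` is `x · g`. -/
noncomputable instance (θ : IrrUnit) : MulAction DInfᵐᵒᵖ (CutCircle θ) :=
  dihedralRightAction flipA flipB flipA_involutive flipB_involutive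

theorem op_genA_smul (p : CutCircle θ) : op genA • p = p.flipA := rfl

theorem op_genB_smul (p : CutCircle θ) : op genB • p = p.flipB := by
  show ((flipB_involutive.toPerm flipB * flipA_involutive.toPerm flipA) ^ (1 : ℤ) :
    Equiv.Perm (CutCircle θ)) (flipA p) = p.flipB
  rw [zpow_one]
  show flipB (flipA (flipA p)) = flipB p
  rw [flipA_involutive p]

/-- The clopen interval `[x, y] = [x + 0, y - 0]`, for `x < y` in the orbit of `0`. -/
def seg (x y : ℝ) : Set (CutCircle θ) :=
  {p | toLex (x, (1 : SignType)) ≤ p.1 ∧ p.1 ≤ toLex (y, (-1 : SignType))}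

theorem mul_mem_cutSet (y : ℝ) : θ.1 * y ∈ cutSet θ.1 ↔ y ∈ cutSet (gauss θ).1 := by
  have h0 : θ.1 ≠ 0 := θ.2.2.1.ne'
  show _ ↔ y ∈ cutSet (1 / θ.1 - (cfDigit θ : ℝ))
  constructor
  · rintro ⟨m, n, h⟩
    refine ⟨n + m * cfDigit θ, m, ?_⟩
    have : y = (m + n * θ.1) / θ.1 := by rw [← h]; field_simp
    rw [this]
    push_cast
    field_simp
    ring
  · rintro ⟨m, n, h⟩
    refine ⟨n, m - n * cfDigit θ, ?_⟩
    rw [h]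
    push_cast
    field_simp
    ring

/-- The inverse `y ↦ θ y` of the similarity `S : [0, θ] → [0, 1]`, `S x = x / θ`, as a map from
the cut circle of `θ' = gauss θ` to the cut circle of `θ`. -/
noncomputable def scale (θ : IrrUnit) (p : CutCircle (gauss θ)) : CutCircle θ :=
  mk (θ.1 * p.pos) p.side (mul_nonneg θ.2.2.1.le p.pos_nonneg)
    (by nlinarith [p.pos_nonneg, p.pos_le_one, θ.2.2.1, θ.2.2.2])
    (by rw [mul_mem_cutSet]; exact p.side_eq_zero)
    (fun h => p.side_of_pos_zero ((mul_eq_zero.mp h).resolve_left θ.2.2.1.ne'))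
    (fun h => by
      exfalso
      nlinarith [p.pos_nonneg, p.pos_le_one, θ.2.2.1, θ.2.2.2])

end CutCircle

/-! ### Rokhlin-Kakutani sets and their Bratteli diagrams -/

/-- The data of a finite collection of towers, indexed by `ι`, for a right action of a group `G`
on `X`: the tower `v` has the base `base v`, and its elements are the translates
`base v · g` for `g ∈ elts v`. -/
structure RKSet (ι G X : Type) where
  base : ι → Set X
  elts : ι → Set G

namespace RKSet

variable {ι κ G X : Type} [Group G] [MulAction Gᵐᵒᵖ X]

/-- The element `base v · g` of the tower `v`. -/
def floor (A : RKSet ι G X) (v : ι) (g : G) : Set X := (fun x => op g • x) '' A.base v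

/-- `A` is a Rokhlin-Kakutani set with respect to the generating set `S`: each tower contains its
base and is a finite collection of nonempty clopen intervals that are moved to each other by
generators, and the elements of all the towers together form a partition of `X`. -/
structure IsRK [TopologicalSpace X] [Preorder X] (A : RKSet ι G X) (S : Set G) : Prop where
  one_mem : ∀ v, 1 ∈ A.elts v
  finite : ∀ v, (A.elts v).Finite
  nonempty : ∀ v, (A.base v).Nonempty
  clopen : ∀ v, ∀ g ∈ A.elts v, IsClopen (A.floor v g)
  interval : ∀ v, ∀ g ∈ A.elts v, (A.floor v g).OrdConnected
  moved : ∀ v, ∀ g ∈ A.elts v,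
    Relation.ReflTransGen (fun h h' => h' ∈ A.elts v ∧ ∃ s ∈ S, h' = h * s) 1 g
  disjoint : ∀ v w, ∀ g ∈ A.elts v, ∀ h ∈ A.elts w, (v, g) ≠ (w, h) →
    Disjoint (A.floor v g) (A.floor w h)
  cover : ∀ x, ∃ v, ∃ g ∈ A.elts v, x ∈ A.floor v g

/-- `A ≺ B`: each tower of `B` is obtained from its elements that lie in the bases of `A` by moving
them along the towers of `A`. -/
def Refines (A : RKSet ι G X) (B : RKSet κ G X) : Prop :=
  ∀ v k, k ∈ B.elts v ↔
    ∃ u, ∃ g ∈ A.elts u, ∃ h ∈ B.elts v, B.floor v h ⊆ A.base u ∧ k = h * g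

end RKSet

/-- Vertices, edges, sources and ranges of a Bratteli diagram; `E n` is the set of edges from
level `n` to level `n + 1`. -/
structure BratteliData where
  V : ℕ → Type
  E : ℕ → Type
  src : ∀ {n}, E n → V n
  rng : ∀ {n}, E n → V (n + 1)

namespace BratteliData

/-- The vertex and edge sets are finite, and the source and range maps are surjective. -/
structure IsBratteli (B : BratteliData) : Prop where
  finite_V : ∀ n, Finite (B.V n)
  finite_E : ∀ n, Finite (B.E n)
  src_surjective : ∀ n, Function.Surjective (B.src (n := n))
  rng_surjective : ∀ n, Function.Surjective (B.rng (n := n))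

/-- The number of edges from the vertex `u` of level `n` to the vertex `v` of level `n + 1`. -/
noncomputable def mult (B : BratteliData) (n : ℕ) (u : B.V n) (v : B.V (n + 1)) : ℕ :=
  Nat.card {e : B.E n // B.src e = u ∧ B.rng e = v}

/-- The space of infinite paths. -/
def Path (B : BratteliData) : Type :=
  {γ : ∀ n, B.E n // ∀ n, B.rng (γ n) = B.src (γ (n + 1))}

/-- The subspace topology in the product of the discrete sets of edges. -/
instance (B : BratteliData) : TopologicalSpace B.Path :=
  TopologicalSpace.induced Subtype.val (@Pi.topologicalSpace ℕ B.E fun _ => ⊥)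

end BratteliData

section RKDiagram

variable {ι : ℕ → Type} {G X : Type} [Group G] [MulAction Gᵐᵒᵖ X]

/-- An edge from the tower `src` of `A` to the tower `rng` of `B`: an element `base · elt` of the
tower `rng` that is contained in the base of the tower `src`. -/
structure RKEdge {ι κ : Type} (A : RKSet ι G X) (B : RKSet κ G X) where
  src : ι
  rng : κ
  elt : G
  mem : elt ∈ B.elts rng
  sub : B.floor rng elt ⊆ A.base src

/-- The Bratteli diagram associated with a sequence of Rokhlin-Kakutani sets. -/
def rkDiagram (A : ∀ n, RKSet (ι n) G X) : BratteliData where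
  V := ι
  E n := RKEdge (A n) (A (n + 1))
  src e := e.src
  rng e := e.rng

/-- For a path `γ` with edges `e_1, e_2, ...` that correspond to the elements
`base · g_1, base · g_2, ...` of towers, the product `g_n ⋯ g_2 g_1`; it moves the base of the
tower that corresponds to the end of `e_n ⋯ e_1`. -/
def pathElt {A : ∀ n, RKSet (ι n) G X} (γ : (rkDiagram A).Path) : ℕ → G
  | 0 => 1
  | n + 1 => RKEdge.elt (γ.1 n) * pathElt γ n

/-- The subset of `X` encoded by the beginning `e_{n+1} ⋯ e_1` of a path. -/
def pathCell {A : ∀ n, RKSet (ι n) G X} (γ : (rkDiagram A).Path) (n : ℕ) : Set X :=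
  (A (n + 1)).floor (RKEdge.rng (γ.1 n)) (pathElt γ (n + 1))

/-- A right action of `G` on the path space by homeomorphisms (`ρ (op g) γ` is `γ · g`) is natural
if it moves paths as the elements of the towers are moved: whenever
`γ = ... e_{n+2} e_{n+1} e_n ... e_1` and `γ' = ... e_{n+2} e_{n+1} e'_n ... e'_1`
differ in the first `n` edges only, the element `g⁻¹ g'` of `G`, which moves the tower element
`base · g` of `e_n ... e_1` to the element `base · g'` of `e'_n ... e'_1` in the same tower, maps
`γ` to `γ'`. -/
def IsNaturalAction (A : ∀ n, RKSet (ι n) G X)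
    (ρ : Gᵐᵒᵖ →* ((rkDiagram A).Path ≃ₜ (rkDiagram A).Path)) : Prop :=
  ∀ (γ γ' : (rkDiagram A).Path) (n : ℕ), (∀ k, n ≤ k → γ.1 k = γ'.1 k) →
    ρ (op ((pathElt γ n)⁻¹ * pathElt γ' n)) γ = γ'

end RKDiagram

/-! ### The Rokhlin-Kakutani sets of the dihedral action -/

/-- The intervals `[0, θ]` and `[θ, 1]`. -/
def baseZero (θ : IrrUnit) (u : Fin 2) : Set (CutCircle θ) :=
  if u = 0 then CutCircle.seg 0 θ.1 else CutCircle.seg θ.1 1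

/-- The heights of the two towers of level one: `r + 1` and `r`, where `r = ⌊1/θ⌋`. -/
noncomputable def rkHeight (θ : IrrUnit) (u : Fin 2) : ℕ :=
  if u = 0 then cfDigit θ + 1 else cfDigit θ

/-- The sets `𝒜_0 ≺ 𝒜_1 ≺ ...`.  The towers of `𝒜_0` are `{[0, θ]}` and `{[θ, 1]}`.
The set `𝒜_{n+1}` of `θ` is obtained from the set `𝒜_n` of `θ'`, which is identified with
a collection of towers in `[0, θ]` by the similarity `y ↦ θ y`.  Its bases are the images
of the bases; the moves in the towers are those elements `h` of the group that act on the image of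
the base like `g'` acts on the base; and the images of the elements of the towers in `[0, θ']` and
in `[θ', 1]`, are then moved along the towers with bases
`I_0 = θ [0, θ'] = [0, 1 - r θ]` and `J_0 = θ [θ', 1] = [1 - r θ, θ]` by
`1, a, ab, aba, ...` (`r + 1` and `r` translates, respectively).  In particular the
towers of `𝒜_1` are `{I_0, I_0 · a, I_0 · ab, ...}` and `{J_0, J_0 · a, J_0 · ab, ...}`. -/
noncomputable def dihedralRK : (n : ℕ) → (θ : IrrUnit) → RKSet (Fin 2) DInf (CutCircle θ)
  | 0, θ => { base := baseZero θ, elts := fun _ => {1} }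
  | n + 1, θ =>
    let A' := dihedralRK n (gauss θ)
    { base := fun v => CutCircle.scale θ '' A'.base v
      elts := fun v => {g | ∃ g' ∈ A'.elts v, ∃ h : DInf, ∃ u : Fin 2, ∃ k < rkHeight θ u,
        (∀ y ∈ A'.base v, op h • CutCircle.scale θ y = CutCircle.scale θ (op g' • y)) ∧
        A'.floor v g' ⊆ baseZero (gauss θ) u ∧ g = h * altWord k} }

/-- The Bratteli diagram associated with `𝒜_0 ≺ 𝒜_1 ≺ ...`; each of its levels has the vertices
`0` and `1`. -/
noncomputable def dihedralDiagram (θ : IrrUnit) : BratteliData :=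
  rkDiagram (ι := fun _ => Fin 2) (fun n => dihedralRK n θ)

/-! Renormalization drives the proof. The similarity `scale` identifies the cut circle of `θ' =
gauss θ` with `[0, θ]`. Under it, `a` becomes `b` (`scale_smul_genA`), and on each of `[0, θ']`,
`[θ', 1]` the involution `b` becomes one reflection of the big circle, which depends on the interval
(`scale_smul_genB`). Over `[0, θ]` the alternating words build two columns of heights `r + 1` and
`r` that partition the big circle: an odd word lists the floors of the rotation column from the top,
an even word from the bottom (`altWord_smul_odd`, `altWord_scale_unique`, `exists_altWord_scale`).
Hence a partition into towers for `θ'` lifts to one for `θ`. Lifts of group elements are unique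
because cut points have trivial stabilizers, and they are multiplicative along towers, which gives
refinement. The edges of a level correspond to those of the previous level for `θ'`, so
multiplicities only have to be counted between the first two levels.

The induction `IsGood.succ` carries two metric facts with bound `θ_0 ⋯ θ_{n-1}`, which tends to
zero: a floor of the `n`-th towers has at most this diameter in position, and a generator that leads
out of a tower moves the points of the floor at most this far. A generator changes the position of
every cut point, so from some level on it keeps a given cut point inside its tower.

This settles both delicate points. For separation, points sharing all floors have equal position;
the only danger is the pair `x - 0`, `x + 0`. For cut points, sharing all floors is invariant under
the group, and each cut point can be moved to position `0` or `1`, where the position determines the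
side (`SameFloors.eq`). For uniqueness, a generator changes only a finite beginning of the path of a
cut point, so naturality prescribes the image; cut points are dense, and continuity does the rest
(`IsRKSequence.eq_pathAction`).

Existence is formal: in a compact space a separating refining sequence codes points homeomorphically
by paths (`IsRKSequence.coding`), and the transported action is natural. -/

/-! ### Arithmetic of the dihedral group and of alternating words -/

/-- The rotation `x ↦ x + iθ`. -/
def rot (i : ℤ) : DInf := DihedralGroup.r i

/-- The reflection `x ↦ iθ - x`. -/
def reflec (i : ℤ) : DInf := DihedralGroup.sr i

theorem rot_mul_rot (i j : ℤ) : rot i * rot j = rot (i + j) := rfl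
theorem rot_mul_reflec (i j : ℤ) : rot i * reflec j = reflec (j - i) := rfl
theorem reflec_mul_rot (i j : ℤ) : reflec i * rot j = reflec (i + j) := rfl
theorem reflec_mul_reflec (i j : ℤ) : reflec i * reflec j = rot (j - i) := rfl
theorem rot_zero : rot 0 = 1 := rfl
theorem genA_eq : genA = reflec 0 := rfl
theorem genB_eq : genB = reflec 1 := rfl

theorem rot_or_reflec (g : DInf) : (∃ i, g = rot i) ∨ ∃ i, g = reflec i := by
  rcases g with i | i
  · exact Or.inl ⟨i, rfl⟩
  · exact Or.inr ⟨i, rfl⟩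

theorem genA_mul_self : genA * genA = 1 := rfl
theorem genB_mul_self : genB * genB = 1 := rfl

theorem closure_genA_genB : Subgroup.closure ({genA, genB} : Set DInf) = ⊤ := by
  rw [eq_top_iff]
  intro g _
  have ha : genA ∈ Subgroup.closure ({genA, genB} : Set DInf) := Subgroup.subset_closure (by simp)
  have hb : genB ∈ Subgroup.closure ({genA, genB} : Set DInf) := Subgroup.subset_closure (by simp)
  have hr : ∀ i : ℤ, rot i ∈ Subgroup.closure ({genA, genB} : Set DInf) := by
    intro i
    have : rot i = (genA * genB) ^ i := by
      have : genA * genB = (DihedralGroup.r 1 : DInf) := rfl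
      rw [this, DihedralGroup.r_one_zpow]
      rfl
    rw [this]
    exact Subgroup.zpow_mem _ (Subgroup.mul_mem _ ha hb) _
  rcases rot_or_reflec g with ⟨i, rfl⟩ | ⟨i, rfl⟩
  · exact hr i
  · have : reflec i = genA * rot i := by rw [genA_eq, reflec_mul_rot, zero_add]
    rw [this]
    exact Subgroup.mul_mem _ ha (hr i)

/-- The product `ab` is the rotation by `θ`, so even words rotate forward while odd words are
reflections with decreasing index. -/
theorem altWord_two_mul (j : ℕ) :
    altWord (2 * j) = rot j ∧ altWord (2 * j + 1) = reflec (-(j : ℤ)) := by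
  induction j with
  | zero => exact ⟨rfl, rfl⟩
  | succ j ih =>
    have h : altWord (2 * (j + 1)) = rot ((j + 1 : ℕ) : ℤ) := by
      show altWord (2 * j + 1) * (if Even (2 * j + 1) then genA else genB) = _
      rw [if_neg (by simp), ih.2, genB_eq, reflec_mul_reflec]
      congr 1
      push_cast
      ring
    refine ⟨h, ?_⟩
    show altWord (2 * (j + 1)) * (if Even (2 * (j + 1)) then genA else genB) = _
    rw [if_pos (by simp), h, genA_eq, rot_mul_reflec, zero_sub]

/-- The letter that follows `altWord k` in the alternating word. -/
def altLetter (k : ℕ) : DInf := if Even k then genA else genB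

theorem altWord_succ (k : ℕ) : altWord (k + 1) = altWord k * altLetter k := rfl

theorem altLetter_mul_self (k : ℕ) : altLetter k * altLetter k = 1 := by
  unfold altLetter
  split_ifs <;> rfl

theorem altWord_succ_mul_altLetter (k : ℕ) : altWord (k + 1) * altLetter k = altWord k := by
  rw [altWord_succ, mul_assoc, altLetter_mul_self, mul_one]

theorem altLetter_mem (k : ℕ) : altLetter k ∈ ({genA, genB} : Set DInf) := by
  unfold altLetter
  split_ifs <;> simp

/-- Conjugating the letter after `altWord k` by `altWord k` gives the reflection `-k`. -/
theorem altWord_mul_altLetter (k : ℕ) : altWord k * altLetter k = reflec (-(k : ℤ)) * altWord k := by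
  rcases Nat.even_or_odd' k with ⟨j, rfl | rfl⟩
  · rw [(altWord_two_mul j).1, altLetter, if_pos (by simp), genA_eq, rot_mul_reflec, reflec_mul_rot]
    congr 1
    push_cast
    ring
  · rw [(altWord_two_mul j).2, altLetter, if_neg (by simp), genB_eq, reflec_mul_reflec, reflec_mul_reflec]
    congr 1
    push_cast
    ring

/-- On floor `k` of a column one generator leads up; the other is the letter that led there from
floor `k - 1`, by parity. -/
theorem eq_altLetter_of_mem {s : DInf} (hs : s ∈ ({genA, genB} : Set DInf)) (k : ℕ) :
    s = altLetter k ∨ s = altLetter (k + 1) := by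
  unfold altLetter
  by_cases h : Even k
  · have h' : ¬ Even (k + 1) := by simpa [Nat.even_add_one] using h
    rw [if_pos h, if_neg h']
    exact hs
  · have h' : Even (k + 1) := by simpa [Nat.even_add_one] using h
    rw [if_neg h, if_pos h']
    exact hs.symm

/-! ### The Gauss map and the column heights -/

theorem cfDigit_pos (θ : IrrUnit) : 0 < cfDigit θ := by
  unfold cfDigit
  rw [Nat.floor_pos]
  exact (one_le_div θ.2.2.1).mpr θ.2.2.2.le

theorem mul_gauss (θ : IrrUnit) : θ.1 * (gauss θ).1 = 1 - cfDigit θ * θ.1 := by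
  show θ.1 * (1 / θ.1 - (cfDigit θ : ℝ)) = _
  have h0 : θ.1 ≠ 0 := θ.2.2.1.ne'
  field_simp

theorem rkHeight_pos (θ : IrrUnit) (u : Fin 2) : 0 < rkHeight θ u := by
  unfold rkHeight
  have := cfDigit_pos θ
  split_ifs <;> omega

theorem int_add_mul_eq_zero (θ : IrrUnit) {m n : ℤ} (h : (m : ℝ) + n * θ.1 = 0) :
    m = 0 ∧ n = 0 := by
  have hn : n = 0 := by
    by_contra hn
    have hn' : (n : ℝ) ≠ 0 := by exact_mod_cast hn
    apply θ.2.1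
    refine ⟨-m / n, ?_⟩
    push_cast
    field_simp
    linarith
  subst hn
  refine ⟨?_, rfl⟩
  have : (m : ℝ) = 0 := by simpa using h
  exact_mod_cast this

/-! ### The action on the cut circle in coordinates -/

namespace CutCircle

variable {θ : IrrUnit}

theorem le_iff (p q : CutCircle θ) : p ≤ q ↔ p.pos < q.pos ∨ (p.pos = q.pos ∧ p.side ≤ q.side) :=
  Prod.Lex.le_iff

theorem lt_iff (p q : CutCircle θ) : p < q ↔ p.pos < q.pos ∨ (p.pos = q.pos ∧ p.side < q.side) :=
  Prod.Lex.lt_iff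

theorem pos_mono {p q : CutCircle θ} (h : p ≤ q) : p.pos ≤ q.pos := by
  rcases (le_iff p q).mp h with h | h
  · exact h.le
  · exact h.1.le

@[simp] theorem mk_pos (x : ℝ) (s : SignType) (h0 : 0 ≤ x) (h1 : x ≤ 1)
    (h : s = 0 ↔ x ∉ cutSet θ.1) (hz : x = 0 → s = 1) (ho : x = 1 → s = -1) :
    (mk x s h0 h1 h hz ho).pos = x := rfl

@[simp] theorem mk_side (x : ℝ) (s : SignType) (h0 : 0 ≤ x) (h1 : x ≤ 1)
    (h : s = 0 ↔ x ∉ cutSet θ.1) (hz : x = 0 → s = 1) (ho : x = 1 → s = -1) :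
    (mk x s h0 h1 h hz ho).side = s := rfl

/-- A point is determined by its class modulo `1` and its side. -/
theorem ext_mod {p q : CutCircle θ} (m : ℤ) (h1 : p.pos = q.pos + m) (h2 : p.side = q.side) :
    p = q := by
  have hp0 := p.pos_nonneg
  have hp1 := p.pos_le_one
  have hq0 := q.pos_nonneg
  have hq1 := q.pos_le_one
  have hm1 : m ≤ 1 := by
    have : (m : ℝ) ≤ 1 := by linarith
    exact_mod_cast this
  have hm2 : -1 ≤ m := by
    have : (-1 : ℝ) ≤ m := by linarith
    exact_mod_cast this
  obtain rfl | rfl | rfl : m = -1 ∨ m = 0 ∨ m = 1 := by omega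
  · push_cast at h1
    have a := p.side_of_pos_zero (by linarith)
    have b := q.side_of_pos_one (by linarith)
    rw [a, b] at h2
    exact absurd h2 (by decide)
  · exact ext' (by simpa using h1) h2
  · push_cast at h1
    have a := p.side_of_pos_one (by linarith)
    have b := q.side_of_pos_zero (by linarith)
    rw [a, b] at h2
    exact absurd h2 (by decide)

theorem flipA_pos (p : CutCircle θ) : p.flipA.pos = 1 - p.pos := rfl
theorem flipA_side (p : CutCircle θ) : p.flipA.side = -p.side := rfl

theorem flipB_side (p : CutCircle θ) : p.flipB.side = -p.side := by
  by_cases h : p.IsLow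
  · exact (flipB_of_isLow h).2
  · exact (flipB_of_not_isLow h).2

theorem flipB_pos (p : CutCircle θ) : ∃ m : ℤ, p.flipB.pos = -p.pos + θ.1 + m := by
  by_cases h : p.IsLow
  · exact ⟨0, by rw [(flipB_of_isLow h).1]; push_cast; ring⟩
  · exact ⟨1, by rw [(flipB_of_not_isLow h).1]; push_cast; ring⟩

theorem flipB_isLow (p : CutCircle θ) : p.flipB.IsLow ↔ p.IsLow := by
  have key : ∀ p : CutCircle θ, p.IsLow → p.flipB.IsLow := by
    intro p h
    obtain ⟨h1, h2⟩ := flipB_of_isLow h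
    rw [isLow_iff, h1, h2]
    rcases p.pos_nonneg.lt_or_eq with h0 | h0
    · left; linarith
    · right; exact ⟨by linarith, by rw [p.side_of_pos_zero h0.symm]⟩
  refine ⟨fun h => ?_, key p⟩
  have := key _ h
  rwa [flipB_involutive p] at this

theorem smul_mul (g h : DInf) (p : CutCircle θ) : op (g * h) • p = op h • op g • p := by
  rw [op_mul, mul_smul]

theorem op_one_smul (p : CutCircle θ) : op (1 : DInf) • p = p := one_smul _ p

theorem op_inv_smul_smul (g : DInf) (p : CutCircle θ) : op g⁻¹ • op g • p = p := by
  rw [← smul_mul, mul_inv_cancel, op_one_smul]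

theorem rot_smul_nat (n : ℕ) (p : CutCircle θ) :
    ∃ m : ℤ, (op (rot n) • p).pos = p.pos + n * θ.1 + m ∧ (op (rot n) • p).side = p.side := by
  induction n with
  | zero => exact ⟨0, by simp [rot_zero], by simp [rot_zero]⟩
  | succ n ih =>
    obtain ⟨m, h1, h2⟩ := ih
    have : rot ((n + 1 : ℕ) : ℤ) = rot n * genA * genB := by
      rw [genA_eq, genB_eq, rot_mul_reflec, reflec_mul_reflec]
      congr 1
      push_cast
      ring
    rw [this, smul_mul, smul_mul, op_genA_smul, op_genB_smul]
    obtain ⟨m', h3⟩ := flipB_pos (op (rot n) • p).flipA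
    refine ⟨m + m' - 1, ?_, ?_⟩
    · rw [h3, flipA_pos, h1]; push_cast; ring
    · rw [flipB_side, flipA_side, h2, neg_neg]

theorem rot_smul (i : ℤ) (p : CutCircle θ) :
    ∃ m : ℤ, (op (rot i) • p).pos = p.pos + i * θ.1 + m ∧ (op (rot i) • p).side = p.side := by
  obtain ⟨n, rfl | rfl⟩ := i.eq_nat_or_neg
  · exact_mod_cast rot_smul_nat n p
  · obtain ⟨m, h1, h2⟩ := rot_smul_nat n (op (rot (-n)) • p)
    rw [← smul_mul, rot_mul_rot, neg_add_cancel, rot_zero, op_one_smul] at h1 h2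
    exact ⟨-m, by rw [h1]; push_cast; ring, h2.symm⟩

theorem reflec_smul (i : ℤ) (p : CutCircle θ) :
    ∃ m : ℤ, (op (reflec i) • p).pos = -p.pos + i * θ.1 + m ∧ (op (reflec i) • p).side = -p.side := by
  have : reflec i = genA * rot i := by rw [genA_eq, reflec_mul_rot, zero_add]
  rw [this, smul_mul, op_genA_smul]
  obtain ⟨m, h1, h2⟩ := rot_smul i p.flipA
  refine ⟨m + 1, ?_, ?_⟩
  · rw [h1, flipA_pos]; push_cast; ring
  · rw [h2, flipA_side]

/-- Since the class modulo `1` and the side determine a point, images can be identified without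
tracking where wrapping occurs. -/
theorem rot_smul_eq {p q : CutCircle θ} (i m : ℤ) (h1 : q.pos = p.pos + i * θ.1 + m)
    (h2 : q.side = p.side) : op (rot i) • p = q := by
  obtain ⟨m', h3, h4⟩ := rot_smul i p
  refine ext_mod (m' - m) ?_ (by rw [h4, h2])
  rw [h3, h1]; push_cast; ring

theorem reflec_smul_eq {p q : CutCircle θ} (i m : ℤ) (h1 : q.pos = -p.pos + i * θ.1 + m)
    (h2 : q.side = -p.side) : op (reflec i) • p = q := by
  obtain ⟨m', h3, h4⟩ := reflec_smul i p
  refine ext_mod (m' - m) ?_ (by rw [h4, h2])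
  rw [h3, h1]; push_cast; ring

theorem smul_side_eq_zero (g : DInf) (p : CutCircle θ) : (op g • p).side = 0 ↔ p.side = 0 := by
  rcases rot_or_reflec g with ⟨i, rfl⟩ | ⟨i, rfl⟩
  · obtain ⟨m, -, h⟩ := rot_smul i p
    rw [h]
  · obtain ⟨m, -, h⟩ := reflec_smul i p
    rw [h]
    cases p.side <;> decide

/-- Cut points have trivial stabilizers. -/
theorem eq_of_smul_eq {p : CutCircle θ} (hp : p.side ≠ 0) {g h : DInf} (e : op g • p = op h • p) :
    g = h := by
  have key : ∀ k : DInf, op k • p = p → k = 1 := by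
    intro k hk
    rcases rot_or_reflec k with ⟨i, rfl⟩ | ⟨i, rfl⟩
    · obtain ⟨m, h1, -⟩ := rot_smul i p
      rw [hk] at h1
      obtain ⟨-, rfl⟩ := int_add_mul_eq_zero θ (m := m) (n := i) (by linarith)
      rfl
    · obtain ⟨m, -, h2⟩ := reflec_smul i p
      rw [hk] at h2
      exfalso
      revert hp h2
      cases p.side <;> decide
  have := key (g * h⁻¹) (by rw [smul_mul, e, op_inv_smul_smul])
  exact mul_inv_eq_one.mp this

/-- Each cut point can be moved to one of the ends `0 + 0`, `1 - 0`. -/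
theorem exists_smul_pos_eq {p : CutCircle θ} (hp : p.side ≠ 0) :
    ∃ g : DInf, (op g • p).pos = 0 ∨ (op g • p).pos = 1 := by
  have h : p.pos ∈ cutSet θ.1 := not_not.mp fun h => hp (p.side_eq_zero.mpr h)
  obtain ⟨m, n, h⟩ := h
  obtain ⟨l, h1, -⟩ := rot_smul (-n) p
  refine ⟨rot (-n), ?_⟩
  have e : (op (rot (-n)) • p).pos = ((m + l : ℤ) : ℝ) := by
    rw [h1, h]; push_cast; ring
  have h0 := (op (rot (-n)) • p).pos_nonneg
  have h1 := (op (rot (-n)) • p).pos_le_one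
  rw [e] at h0 h1 ⊢
  have h0' : 0 ≤ m + l := by exact_mod_cast h0
  have h1' : m + l ≤ 1 := by exact_mod_cast h1
  obtain h | h : m + l = 0 ∨ m + l = 1 := by omega
  · left; rw [h]; simp
  · right; rw [h]; simp

/-- The generators move the positions of all cut points. -/
theorem smul_pos_ne {p : CutCircle θ} (hp : p.side ≠ 0) {s : DInf}
    (hs : s ∈ ({genA, genB} : Set DInf)) : (op s • p).pos ≠ p.pos := by
  have h : p.pos ∈ cutSet θ.1 := not_not.mp fun h => hp (p.side_eq_zero.mpr h)
  obtain ⟨m, n, h⟩ := h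
  -- A fixed position `m + nθ` would give `2m = l` and `2n = i`, which fails by parity: `l = 1` for
  -- `a`, `i = 1` for `b`.
  have key : ∀ i l : ℤ, (i = 0 ∧ l = 1) ∨ i = 1 → -p.pos + i * θ.1 + l ≠ p.pos := by
    intro i l hil e
    obtain ⟨h1, h2⟩ := int_add_mul_eq_zero θ (m := 2 * m - l) (n := 2 * n - i) (by
      push_cast; linarith)
    omega
  rcases hs with rfl | rfl
  · rw [op_genA_smul, flipA_pos]
    have := key 0 1 (by simp)
    intro e
    apply this
    push_cast
    linarith
  · rw [op_genB_smul]
    obtain ⟨l, hl⟩ := flipB_pos p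
    have := key 1 l (by simp)
    intro e
    apply this
    push_cast
    linarith

/-! ### Topology -/

theorem flipA_lt_flipA {p q : CutCircle θ} : p.flipA < q.flipA ↔ q < p := by
  have hs : ∀ s t : SignType, -s < -t ↔ t < s := by decide
  rw [lt_iff, lt_iff, flipA_pos, flipA_pos, flipA_side, flipA_side, hs]
  constructor
  · rintro (h | ⟨h, h'⟩)
    · left; linarith
    · right; exact ⟨by linarith, h'⟩
  · rintro (h | ⟨h, h'⟩)
    · left; linarith
    · right; exact ⟨by linarith, h'⟩

theorem IsLow.mono {p q : CutCircle θ} (hq : q.IsLow) (h : p ≤ q) : p.IsLow := le_trans h hq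

/-- The involution `b` reverses `[0, θ]` and `[θ, 1]` separately, so the order is reversed only
between points on the same side of the cut at `θ`. -/
theorem flipB_lt_flipB {p q : CutCircle θ} (hpq : p.IsLow ↔ q.IsLow) :
    p.flipB < q.flipB ↔ q < p := by
  have hs : ∀ s t : SignType, -s < -t ↔ t < s := by decide
  have e : p.flipB.pos - q.flipB.pos = q.pos - p.pos := by
    by_cases h : p.IsLow
    · rw [(flipB_of_isLow h).1, (flipB_of_isLow (hpq.mp h)).1]; ring
    · rw [(flipB_of_not_isLow h).1, (flipB_of_not_isLow (fun h' => h (hpq.mpr h'))).1]; ring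
  rw [lt_iff, lt_iff, flipB_side, flipB_side, hs]
  constructor
  · rintro (h | ⟨h, h'⟩)
    · left; linarith
    · right; exact ⟨by linarith, h'⟩
  · rintro (h | ⟨h, h'⟩)
    · left; linarith
    · right; exact ⟨by linarith, h'⟩

theorem flipA_le_flipA {p q : CutCircle θ} : p.flipA ≤ q.flipA ↔ q ≤ p := by
  rw [← not_lt, ← not_lt, flipA_lt_flipA]

theorem flipB_le_flipB {p q : CutCircle θ} (hpq : p.IsLow ↔ q.IsLow) :
    p.flipB ≤ q.flipB ↔ q ≤ p := by
  rw [← not_lt, ← not_lt, flipB_lt_flipB hpq.symm]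

/-- The point `θ - 0`. -/
noncomputable def thetaMinus (θ : IrrUnit) : CutCircle θ :=
  mk θ.1 (-1) θ.2.2.1.le θ.2.2.2.le
    (by simp only [theta_mem_cutSet, not_true_eq_false, iff_false]; decide)
    (fun h => absurd h θ.2.2.1.ne') (fun h => absurd h θ.2.2.2.ne)

/-- The point `θ + 0`. -/
noncomputable def thetaPlus (θ : IrrUnit) : CutCircle θ :=
  mk θ.1 1 θ.2.2.1.le θ.2.2.2.le
    (by simp only [theta_mem_cutSet, not_true_eq_false, iff_false]; decide)
    (fun _ => rfl) (fun h => absurd h θ.2.2.2.ne)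

theorem isLow_iff_le (p : CutCircle θ) : p.IsLow ↔ p ≤ thetaMinus θ := Iff.rfl

theorem not_isLow_iff_le (p : CutCircle θ) : ¬ p.IsLow ↔ thetaPlus θ ≤ p := by
  constructor
  · intro h
    rw [le_iff]
    rcases (p.le_pos_of_not_isLow h).lt_or_eq with h' | h'
    · exact Or.inl h'
    · exact Or.inr ⟨h', (p.side_of_not_isLow h h'.symm).ge⟩
  · intro h h'
    have := le_trans h ((isLow_iff_le p).mp h')
    rw [le_iff] at this
    rcases this with h | ⟨-, h⟩
    · exact lt_irrefl _ h
    · exact absurd (show (1 : SignType) ≤ -1 from h) (by decide)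

theorem isClopen_isLow : IsClopen {p : CutCircle θ | p.IsLow} := by
  refine ⟨isClosed_Iic (a := thetaMinus θ), ?_⟩
  rw [← isClosed_compl_iff]
  have : {p : CutCircle θ | p.IsLow}ᶜ = Ici (thetaPlus θ) := by
    ext p
    exact not_isLow_iff_le p
  rw [this]
  exact isClosed_Ici

/-- An order-reversing bijection is an isomorphism onto the dual order. -/
theorem continuous_flipA : Continuous (flipA (θ := θ)) := by
  let e : CutCircle θ ≃o (CutCircle θ)ᵒᵈ :=
    { flipA_involutive.toPerm.trans OrderDual.toDual with
      map_rel_iff' := flipA_le_flipA }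
  exact continuous_ofDual.comp e.continuous

/-- The cut at `θ` is clopen, so nearby points stay on one side of it. A bound on the same side is
handled by order reversal; for a bound on the other side the comparison depends on the sides of the
cut alone. -/
theorem continuous_flipB : Continuous (flipB (θ := θ)) := by
  rw [continuous_iff_continuousAt]
  intro p
  have hev : ∀ᶠ q in 𝓝 p, (p.IsLow ↔ q.IsLow) := by
    by_cases h : p.IsLow
    · filter_upwards [isClopen_isLow.2.mem_nhds h] with q hq
      exact ⟨fun _ => hq, fun _ => h⟩
    · filter_upwards [isClopen_isLow.compl.2.mem_nhds h] with q hq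
      exact ⟨fun h' => absurd h' h, fun h' => absurd h' hq⟩
  refine tendsto_order.mpr ⟨fun a ha => ?_, fun a ha => ?_⟩
  · by_cases hl : a.IsLow ↔ p.IsLow
    · have h1 : p < a.flipB := by
        rw [← flipB_lt_flipB (by rw [flipB_isLow, hl]), flipB_involutive a]
        exact ha
      filter_upwards [hev, eventually_lt_nhds h1] with q h2 h3
      rw [← flipB_lt_flipB (by rw [flipB_isLow, hl, h2]), flipB_involutive a] at h3
      exact h3
    · filter_upwards [hev] with q h2
      have ha' : a.IsLow := by
        by_contra h
        have : ¬ p.IsLow := fun h' => h (IsLow.mono (p.flipB_isLow.mpr h') ha.le)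
        tauto
      by_contra h3
      have h4 := q.flipB_isLow.mp (IsLow.mono ha' (not_lt.mp h3))
      tauto
  · by_cases hl : a.IsLow ↔ p.IsLow
    · have h1 : a.flipB < p := by
        rw [← flipB_lt_flipB (by rw [flipB_isLow, hl]), flipB_involutive a]
        exact ha
      filter_upwards [hev, eventually_gt_nhds h1] with q h2 h3
      rw [← flipB_lt_flipB (by rw [flipB_isLow, hl, h2]), flipB_involutive a] at h3
      exact h3
    · filter_upwards [hev] with q h2
      by_contra h3
      by_cases hp : p.IsLow
      · exact hl ⟨fun _ => hp,
          fun _ => IsLow.mono (q.flipB_isLow.mpr (h2.mp hp)) (not_lt.mp h3)⟩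
      · have ha' : a.IsLow := by tauto
        exact hp (p.flipB_isLow.mp (IsLow.mono ha' ha.le))

theorem continuous_smul_op (g : DInf) : Continuous fun p : CutCircle θ => op g • p := by
  have h : g ∈ Subgroup.closure ({genA, genB} : Set DInf) := by
    rw [closure_genA_genB]; trivial
  induction h using Subgroup.closure_induction'' with
  | mem x hx =>
    rcases hx with rfl | rfl
    · exact continuous_flipA
    · simp_rw [op_genB_smul]; exact continuous_flipB
  | inv_mem x hx =>
    rcases hx with rfl | rfl
    · exact continuous_flipA
    · have : genB⁻¹ = genB := rfl
      simp_rw [this, op_genB_smul]; exact continuous_flipB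
  | one => simp_rw [op_one_smul]; exact continuous_id
  | mul x y _ _ hx hy =>
    simp_rw [smul_mul]
    exact hy.comp hx

instance : ContinuousConstSMul DInfᵐᵒᵖ (CutCircle θ) :=
  ⟨fun g => continuous_smul_op (unop g)⟩

theorem zero_mem_cutSet (t : ℝ) : (0 : ℝ) ∈ cutSet t := ⟨0, 0, by simp⟩
theorem one_mem_cutSet (t : ℝ) : (1 : ℝ) ∈ cutSet t := ⟨1, 0, by simp⟩

/-- The smallest point `0 + 0`. -/
noncomputable def zeroPlus (θ : IrrUnit) : CutCircle θ :=
  mk 0 1 le_rfl zero_le_one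
    (by simp only [zero_mem_cutSet, not_true_eq_false, iff_false]; decide)
    (fun _ => rfl) (fun h => absurd h zero_ne_one)

theorem zeroPlus_le (p : CutCircle θ) : zeroPlus θ ≤ p := by
  rw [le_iff]
  rcases p.pos_nonneg.lt_or_eq with h | h
  · exact Or.inl h
  · exact Or.inr ⟨h, (p.side_of_pos_zero h.symm).ge⟩

-- If there is no greatest element, the supremum `t` of the positions is not attained, because over
-- one position there are finitely many sides, one of them maximal. The least upper bound is then
-- the lowest point over `t`: `t - 0` at a cut, the single point otherwise.
open Classical in
theorem exists_isLUB (S : Set (CutCircle θ)) : ∃ p, IsLUB S p := by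
  rcases S.eq_empty_or_nonempty with rfl | hS
  · exact ⟨zeroPlus θ, isLUB_empty_iff.mpr zeroPlus_le⟩
  by_cases hmax : ∃ p, IsGreatest S p
  · obtain ⟨p, hp⟩ := hmax
    exact ⟨p, hp.isLUB⟩
  have hbdd : BddAbove (pos '' S) := ⟨1, by rintro _ ⟨p, -, rfl⟩; exact p.pos_le_one⟩
  set t := sSup (pos '' S) with ht
  have hle : ∀ p ∈ S, p.pos ≤ t := fun p hp => le_csSup hbdd ⟨p, hp, rfl⟩
  have hlt : ∀ p ∈ S, p.pos < t := by
    intro p hp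
    refine lt_of_le_of_ne (hle p hp) fun h => hmax ?_
    have hfin : (side '' {q ∈ S | q.pos = t}).Finite := Set.toFinite _
    obtain ⟨s, ⟨⟨q, ⟨hq, hqt⟩, rfl⟩, hs⟩⟩ :=
      hfin.exists_maximal ⟨_, p, ⟨hp, h⟩, rfl⟩
    refine ⟨q, hq, fun z hz => ?_⟩
    rw [le_iff, hqt]
    rcases (hle z hz).lt_or_eq with h' | h'
    · exact Or.inl h'
    · refine Or.inr ⟨h', ?_⟩
      rcases le_total z.side q.side with h4 | h4
      · exact h4
      · exact hs ⟨z, ⟨hz, h'⟩, rfl⟩ h4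
  obtain ⟨p0, hp0⟩ := hS
  have ht0 : 0 < t := lt_of_le_of_lt p0.pos_nonneg (hlt p0 hp0)
  have ht1 : t ≤ 1 := csSup_le ⟨_, p0, hp0, rfl⟩ (by rintro _ ⟨p, -, rfl⟩; exact p.pos_le_one)
  refine ⟨mk t (if t ∈ cutSet θ.1 then -1 else 0) ht0.le ht1 ?_ (fun h => absurd h ht0.ne')
    (fun h => ?_), fun p hp => ?_, fun z hz => ?_⟩
  · by_cases h : t ∈ cutSet θ.1
    · simp [h]
    · simp [h]
  · rw [if_pos (by rw [h]; exact one_mem_cutSet _)]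
  · rw [le_iff]
    exact Or.inl (hlt p hp)
  · have hz1 : t ≤ z.pos := csSup_le ⟨_, p0, hp0, rfl⟩ (by
      rintro _ ⟨p, hp, rfl⟩; exact pos_mono (hz hp))
    rw [le_iff, mk_pos, mk_side]
    rcases hz1.lt_or_eq with h | h
    · exact Or.inl h
    · refine Or.inr ⟨h, ?_⟩
      by_cases h' : t ∈ cutSet θ.1
      · rw [if_pos h']
        cases z.side <;> decide
      · rw [if_neg h', (z.side_eq_zero).mpr (h ▸ h')]

/-- A complete linear order is compact in its order topology. -/
instance : CompactSpace (CutCircle θ) := by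
  classical
  choose f hf using exists_isLUB (θ := θ)
  let _ : SupSet (CutCircle θ) := ⟨f⟩
  let L : CompleteLattice (CutCircle θ) := completeLatticeOfSup (CutCircle θ) hf
  let _ : BoundedOrder (CutCircle θ) := L.toBoundedOrder
  let _ : CompleteLinearOrder (CutCircle θ) :=
    { LinearOrder.toBiheytingAlgebra (CutCircle θ),
      (inferInstance : LinearOrder (CutCircle θ)) with
      sSup := f
      sInf := L.sInf
      isLUB_sSup := hf
      isGLB_sInf := L.isGLB_sInf }
  infer_instance

end CutCircle

namespace CutCircle

variable {θ : IrrUnit}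

/-! ### The similarity and the Kakutani tower over `[0, θ]` -/

theorem scale_pos (y : CutCircle (gauss θ)) : (scale θ y).pos = θ.1 * y.pos := rfl
theorem scale_side (y : CutCircle (gauss θ)) : (scale θ y).side = y.side := rfl

theorem scale_injective : Function.Injective (scale θ) := by
  intro y z h
  refine ext' ?_ ?_
  · have := congrArg pos h
    rw [scale_pos, scale_pos] at this
    exact mul_left_cancel₀ θ.2.2.1.ne' this
  · have := congrArg side h
    exact this

theorem scale_le_scale {y z : CutCircle (gauss θ)} : scale θ y ≤ scale θ z ↔ y ≤ z := by
  rw [le_iff, le_iff, scale_pos, scale_pos, scale_side, scale_side,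
    mul_lt_mul_iff_right₀ θ.2.2.1, mul_right_inj' θ.2.2.1.ne']

theorem scale_isLow (y : CutCircle (gauss θ)) : (scale θ y).IsLow := by
  rw [isLow_iff, scale_pos, scale_side]
  rcases y.pos_le_one.lt_or_eq with h | h
  · left
    have := mul_lt_mul_of_pos_left h θ.2.2.1
    linarith
  · right
    exact ⟨by rw [h, mul_one], y.side_of_pos_one h⟩

theorem IsLow.exists_scale {p : CutCircle θ} (hp : p.IsLow) : ∃ y, scale θ y = p := by
  have h0 := θ.2.2.1
  have e : θ.1 * (p.pos / θ.1) = p.pos := by field_simp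
  refine ⟨mk (p.pos / θ.1) p.side (div_nonneg p.pos_nonneg h0.le)
    (div_le_one_of_le₀ (p.pos_le_of_isLow hp) h0.le) ?_ (fun h => ?_) (fun h => ?_), ?_⟩
  · rw [← mul_mem_cutSet, e]
    exact p.side_eq_zero
  · apply p.side_of_pos_zero
    rw [← e, h, mul_zero]
  · rw [h, mul_one] at e
    rcases p.isLow_iff.mp hp with h' | h'
    · linarith
    · exact h'.2
  · exact ext' e rfl

theorem range_scale : range (scale θ) = {p | p.IsLow} := by
  ext p
  exact ⟨by rintro ⟨y, rfl⟩; exact scale_isLow y, IsLow.exists_scale⟩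

theorem mem_baseZero_zero (p : CutCircle θ) : p ∈ baseZero θ 0 ↔ p.IsLow := by
  show _ ∧ _ ↔ _
  refine ⟨fun h => h.2, fun h => ⟨zeroPlus_le p, h⟩⟩

theorem le_oneMinus (p : CutCircle θ) : p.1 ≤ toLex (1, (-1 : SignType)) := by
  have h : p.pos < 1 ∨ (p.pos = 1 ∧ p.side ≤ -1) := by
    rcases p.pos_le_one.lt_or_eq with h | h
    · exact Or.inl h
    · exact Or.inr ⟨h, (p.side_of_pos_one h).le⟩
  exact Prod.Lex.le_iff.mpr h

theorem mem_baseZero_one (p : CutCircle θ) : p ∈ baseZero θ 1 ↔ ¬ p.IsLow := by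
  rw [not_isLow_iff_le]
  show _ ∧ _ ↔ _
  refine ⟨fun h => h.1, fun h => ⟨h, le_oneMinus p⟩⟩

theorem exists_mem_baseZero (p : CutCircle θ) : ∃ u, p ∈ baseZero θ u := by
  by_cases h : p.IsLow
  · exact ⟨0, (mem_baseZero_zero p).mpr h⟩
  · exact ⟨1, (mem_baseZero_one p).mpr h⟩

theorem baseZero_unique {p : CutCircle θ} {u v : Fin 2} (hu : p ∈ baseZero θ u)
    (hv : p ∈ baseZero θ v) : u = v := by
  revert hu hv
  fin_cases u <;> fin_cases v <;>
    simp only [Fin.zero_eta, Fin.mk_one, mem_baseZero_zero, mem_baseZero_one] <;> tauto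

/-- The involution `b` reflects each of the two intervals in its own midpoint. -/
theorem smul_genB_mem_baseZero {p : CutCircle θ} {u : Fin 2} :
    op genB • p ∈ baseZero θ u ↔ p ∈ baseZero θ u := by
  rw [op_genB_smul]
  fin_cases u <;>
    simp only [Fin.zero_eta, Fin.mk_one, mem_baseZero_zero, mem_baseZero_one, flipB_isLow]

theorem baseZero_eq (u : Fin 2) : baseZero θ u = if u = 0 then {p | p.IsLow} else {p | p.IsLow}ᶜ := by
  ext p
  fin_cases u
  · exact mem_baseZero_zero p
  · exact mem_baseZero_one p

theorem isClopen_baseZero (u : Fin 2) : IsClopen (baseZero θ u) := by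
  rw [baseZero_eq]
  split_ifs
  · exact isClopen_isLow
  · exact isClopen_isLow.compl

theorem ordConnected_baseZero (u : Fin 2) : (baseZero θ u).OrdConnected := by
  rw [baseZero_eq]
  refine ⟨fun p hp q hq z hz => ?_⟩
  split_ifs at hp hq ⊢
  · exact IsLow.mono hq hz.2
  · exact fun h => hp (IsLow.mono h hz.1)

theorem exists_cut_mem_baseZero (u : Fin 2) : ∃ p ∈ baseZero θ u, p.side ≠ 0 := by
  fin_cases u
  · exact ⟨thetaMinus θ, (mem_baseZero_zero _).mpr le_rfl, by
      show (-1 : SignType) ≠ 0; decide⟩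
  · exact ⟨thetaPlus θ, (mem_baseZero_one _).mpr ((not_isLow_iff_le _).mpr le_rfl), by
      show (1 : SignType) ≠ 0; decide⟩

/-- `θ(1 - y) = θ - θy`. -/
theorem scale_smul_genA (y : CutCircle (gauss θ)) :
    scale θ (op genA • y) = op genB • scale θ y := by
  rw [genB_eq]
  refine (reflec_smul_eq 1 0 ?_ ?_).symm
  · rw [scale_pos, scale_pos, op_genA_smul, flipA_pos]; push_cast; ring
  · rw [scale_side, scale_side, op_genA_smul, flipA_side]

/-- With `θθ' = 1 - rθ`, the map `y ↦ θ' - y` becomes `x ↦ 1 - rθ - x`. On the upper interval the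
extra `1` in `1 + θ' - y` contributes another `θ`. In both cases the index is one minus the height
of the column. -/
theorem scale_smul_genB {y : CutCircle (gauss θ)} {u : Fin 2} (hy : y ∈ baseZero (gauss θ) u) :
    scale θ (op genB • y) = op (reflec (1 - (rkHeight θ u : ℤ))) • scale θ y := by
  have h := mul_gauss θ
  refine (reflec_smul_eq _ 1 ?_ ?_).symm
  · rw [scale_pos, scale_pos, op_genB_smul]
    fin_cases u
    · rw [(flipB_of_isLow ((mem_baseZero_zero _).mp hy)).1]
      simp only [rkHeight, Fin.zero_eta, if_true]
      push_cast
      linear_combination h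
    · rw [(flipB_of_not_isLow ((mem_baseZero_one _).mp hy)).1]
      simp only [rkHeight, Fin.mk_one, one_ne_zero, if_false]
      push_cast
      linear_combination h
  · rw [scale_side, scale_side, op_genB_smul, flipB_side]

/-- The rotation towers stay below `1`. -/
theorem pos_add_le {y : CutCircle (gauss θ)} {u : Fin 2} (hy : y ∈ baseZero (gauss θ) u) {j : ℕ}
    (hj : j < rkHeight θ u) : θ.1 * (y.pos + j) ≤ 1 := by
  have h := mul_gauss θ
  have h0 := θ.2.2.1
  have h1 := (gauss θ).2.2.1
  fin_cases u
  · have h2 := y.pos_le_of_isLow ((mem_baseZero_zero _).mp hy)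
    have h3 : (j : ℝ) ≤ cfDigit θ := by
      have : j ≤ cfDigit θ := by
        simp only [rkHeight, Fin.zero_eta, if_true] at hj
        omega
      exact_mod_cast this
    nlinarith
  · have h2 := y.pos_le_one
    have h3 : (j : ℝ) + 1 ≤ cfDigit θ := by
      have : j + 1 ≤ cfDigit θ := by
        simp only [rkHeight, Fin.mk_one, one_ne_zero, if_false] at hj
        omega
      exact_mod_cast this
    nlinarith

/-- No wrapping occurs along the rotation towers. -/
theorem rot_scale {y : CutCircle (gauss θ)} {u : Fin 2} (hy : y ∈ baseZero (gauss θ) u) {j : ℕ}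
    (hj : j < rkHeight θ u) :
    (op (rot j) • scale θ y).pos = θ.1 * (y.pos + j) ∧ (op (rot j) • scale θ y).side = y.side := by
  have h0 := θ.2.2.1
  have hle := pos_add_le hy hj
  have hcut : θ.1 * (y.pos + j) ∈ cutSet θ.1 ↔ y.pos ∈ cutSet (gauss θ).1 := by
    rw [← mul_mem_cutSet]
    constructor
    · rintro ⟨m, n, e⟩
      exact ⟨m, n - j, by push_cast; linear_combination e⟩
    · rintro ⟨m, n, e⟩
      exact ⟨m, n + j, by push_cast; linear_combination e⟩
  have hy0 := y.pos_nonneg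
  have e : op (rot j) • scale θ y = mk (θ.1 * (y.pos + j)) y.side (by positivity) hle
      (by rw [hcut]; exact y.side_eq_zero)
      (fun h => by
        have : y.pos + j = 0 := (mul_eq_zero.mp h).resolve_left h0.ne'
        exact y.side_of_pos_zero (by linarith [(Nat.cast_nonneg j : (0 : ℝ) ≤ j)]))
      -- Position `1` is impossible over the upper interval; over the lower one it forces the
      -- position `θ'` of `y`, and there `y` can only be `θ' - 0`.
      (fun h => by
        have hmul := mul_gauss θ
        fin_cases u
        · have hl := (mem_baseZero_zero _).mp hy
          have h3 : (j : ℝ) ≤ cfDigit θ := by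
            have : j ≤ cfDigit θ := by
              simp only [rkHeight, Fin.zero_eta, if_true] at hj
              omega
            exact_mod_cast this
          rcases y.isLow_iff.mp hl with h' | h'
          · nlinarith
          · exact h'.2
        · have h3 : (j : ℝ) + 1 ≤ cfDigit θ := by
            have : j + 1 ≤ cfDigit θ := by
              simp only [rkHeight, Fin.mk_one, one_ne_zero, if_false] at hj
              omega
            exact_mod_cast this
          have h4 := mul_pos h0 (gauss θ).2.2.1
          have h5 := y.pos_le_one
          nlinarith) := by
    refine rot_smul_eq _ 0 ?_ rfl
    rw [mk_pos, scale_pos]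
    push_cast
    ring
  rw [e]
  exact ⟨rfl, rfl⟩

theorem rot_scale_unique {y z : CutCircle (gauss θ)} {u v : Fin 2} (hy : y ∈ baseZero (gauss θ) u)
    (hz : z ∈ baseZero (gauss θ) v) {i j : ℕ} (hi : i < rkHeight θ u) (hj : j < rkHeight θ v)
    (e : op (rot i) • scale θ y = op (rot j) • scale θ z) : y = z ∧ i = j := by
  obtain ⟨h1, h2⟩ := rot_scale hy hi
  obtain ⟨h3, h4⟩ := rot_scale hz hj
  rw [e, h3] at h1
  rw [e, h4] at h2
  have h5 := mul_left_cancel₀ θ.2.2.1.ne' h1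
  have h6 : z = y := ext_mod ((i : ℤ) - j) (by push_cast; linarith) h2
  subst h6
  refine ⟨rfl, ?_⟩
  have : (j : ℝ) = i := by linarith
  exact_mod_cast this.symm

theorem exists_rot_scale (x : CutCircle θ) : ∃ (u : Fin 2) (y : CutCircle (gauss θ)) (j : ℕ),
    y ∈ baseZero (gauss θ) u ∧ j < rkHeight θ u ∧ op (rot j) • scale θ y = x := by
  have h0 := θ.2.2.1
  have hmul := mul_gauss θ
  -- the first return time to the lower interval under the inverse rotation
  have hstep : ∀ j : ℕ, (∀ i < j, ¬ (op (rot (-(i : ℤ))) • x).IsLow) →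
      (op (rot (-(j : ℤ))) • x).pos = x.pos - j * θ.1 := by
    intro j
    induction j with
    | zero => intro _; simp [rot_zero]
    | succ j ih =>
      intro h
      have h1 := ih fun i hi => h i (by omega)
      have h2 := h j (by omega)
      have e : rot (-((j + 1 : ℕ) : ℤ)) = rot (-(j : ℤ)) * genB * genA := by
        rw [genA_eq, genB_eq, rot_mul_reflec, reflec_mul_reflec]
        congr 1
        push_cast
        ring
      rw [e, smul_mul, smul_mul, op_genA_smul, op_genB_smul, flipA_pos, (flipB_of_not_isLow h2).1,
        h1]
      push_cast
      ring
  have hex : ∃ j : ℕ, (op (rot (-(j : ℤ))) • x).IsLow := by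
    by_contra! hno
    obtain ⟨j, hj⟩ := exists_nat_gt (1 / θ.1)
    have h1 := hstep j fun i _ => hno i
    have h2 := (op (rot (-(j : ℤ))) • x).pos_nonneg
    have h3 := x.pos_le_one
    rw [div_lt_iff₀ h0] at hj
    linarith
  classical
  have hpos := hstep _ fun i hi => Nat.find_min hex hi
  have hlow := Nat.find_spec hex
  set j := Nat.find hex with hj
  clear_value j
  obtain ⟨y, hy⟩ := hlow.exists_scale
  have hx : op (rot j) • scale θ y = x := by
    rw [hy, ← smul_mul, rot_mul_rot, neg_add_cancel, rot_zero, op_one_smul]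
  rw [← hy, scale_pos] at hpos
  have hx1 := x.pos_le_one
  have hy0 := y.pos_nonneg
  have hth := (gauss θ).2.2.2
  -- More than `r` backward steps inside `[0, 1]` would give `(r + 1)θ ≤ 1`, against `1 - rθ = θθ' <
  -- θ`.
  have hjr : j ≤ cfDigit θ := by
    by_contra h
    have : (cfDigit θ : ℝ) + 1 ≤ j := by exact_mod_cast Nat.not_le.mp h
    nlinarith
  by_cases hl : y.IsLow
  · refine ⟨0, y, j, (mem_baseZero_zero _).mpr hl, ?_, hx⟩
    simp only [rkHeight, if_true]
    omega
  · refine ⟨1, y, j, (mem_baseZero_one _).mpr hl, ?_, hx⟩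
    simp only [rkHeight, one_ne_zero, if_false]
    refine lt_of_le_of_ne hjr fun h => hl ?_
    subst h
    rw [isLow_iff]
    -- After exactly `r` steps, `θy ≤ 1 - rθ = θθ'`. Equality means that `x` is `1 - 0`; rotations
    -- keep the side, so `y` is `θ' - 0` and still lies in the lower interval.
    have h1 : y.pos ≤ (gauss θ).1 := by nlinarith
    rcases h1.lt_or_eq with h1 | h1
    · exact Or.inl h1
    · refine Or.inr ⟨h1, ?_⟩
      have h2 : x.pos = 1 := by rw [h1] at hpos; linarith
      obtain ⟨m, -, h3⟩ := rot_smul (cfDigit θ : ℤ) (scale θ y)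
      rw [hx, scale_side, x.side_of_pos_one h2] at h3
      exact h3.symm

theorem altWord_smul_even {j : ℕ} (x : CutCircle θ) :
    op (altWord (2 * j)) • x = op (rot j) • x := by
  rw [(altWord_two_mul j).1]

/-- In a column of height `H`, the word of length `2j + 1` leads to the rotation floor `H - 1 - j`,
after a flip of the base by the image of `b`. The alternating column is thus the rotation column,
listed alternately from the bottom and from the top. -/
theorem altWord_smul_odd {y : CutCircle (gauss θ)} {u : Fin 2} (hy : y ∈ baseZero (gauss θ) u)
    {j : ℕ} (hj : j < rkHeight θ u) :
    op (altWord (2 * j + 1)) • scale θ y =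
      op (rot ((rkHeight θ u - 1 - j : ℕ) : ℤ)) • scale θ (op genB • y) := by
  rw [(altWord_two_mul j).2, scale_smul_genB hy, ← smul_mul, reflec_mul_rot]
  congr 3
  omega

/-- The first return times to `[0, θ]` along the alternating words. -/
theorem altWord_scale_unique {y z : CutCircle (gauss θ)} {u v : Fin 2}
    (hy : y ∈ baseZero (gauss θ) u) (hz : z ∈ baseZero (gauss θ) v) {k l : ℕ}
    (hk : k < rkHeight θ u) (hl : l < rkHeight θ v)
    (e : op (altWord k) • scale θ y = op (altWord l) • scale θ z) : y = z ∧ k = l := by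
  rcases Nat.even_or_odd' k with ⟨i, rfl | rfl⟩ <;> rcases Nat.even_or_odd' l with ⟨j, rfl | rfl⟩
  · rw [altWord_smul_even, altWord_smul_even] at e
    obtain ⟨h1, h2⟩ := rot_scale_unique hy hz (by omega) (by omega) e
    exact ⟨h1, by rw [h2]⟩
  · rw [altWord_smul_even, altWord_smul_odd hz (by omega)] at e
    obtain ⟨h1, h2⟩ := rot_scale_unique hy (smul_genB_mem_baseZero.mpr hz) (by omega) (by omega) e
    subst h1
    obtain rfl := baseZero_unique hy (smul_genB_mem_baseZero.mpr hz)
    -- Agreement would require `i + j = H - 1` for the common height `H`, while `2i < H` and `2j + 1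
    -- < H`.
    omega
  · rw [altWord_smul_even, altWord_smul_odd hy (by omega)] at e
    obtain ⟨h1, h2⟩ := rot_scale_unique (smul_genB_mem_baseZero.mpr hy) hz (by omega) (by omega) e
    subst h1
    obtain rfl := baseZero_unique hz (smul_genB_mem_baseZero.mpr hy)
    omega
  · rw [altWord_smul_odd hy (by omega), altWord_smul_odd hz (by omega)] at e
    obtain ⟨h1, h2⟩ := rot_scale_unique (smul_genB_mem_baseZero.mpr hy)
      (smul_genB_mem_baseZero.mpr hz) (by omega) (by omega) e
    have h3 : y = z := by
      rw [op_genB_smul, op_genB_smul] at h1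
      exact flipB_involutive.injective h1
    subst h3
    obtain rfl := baseZero_unique hy hz
    exact ⟨rfl, by omega⟩

theorem exists_altWord_scale (x : CutCircle θ) : ∃ (u : Fin 2) (y : CutCircle (gauss θ)) (k : ℕ),
    y ∈ baseZero (gauss θ) u ∧ k < rkHeight θ u ∧ op (altWord k) • scale θ y = x := by
  obtain ⟨u, y, j, hy, hj, rfl⟩ := exists_rot_scale x
  by_cases h : 2 * j < rkHeight θ u
  · exact ⟨u, y, 2 * j, hy, h, altWord_smul_even _⟩
  · refine ⟨u, op genB • y, 2 * (rkHeight θ u - 1 - j) + 1, smul_genB_mem_baseZero.mpr hy,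
      by omega, ?_⟩
    rw [altWord_smul_odd (smul_genB_mem_baseZero.mpr hy) (by omega), ← smul_mul, genB_mul_self,
      op_one_smul]
    congr 3
    omega

/-- The floors with `k = 0` already fill `[0, θ]`, and different floors are disjoint. In particular
no floor straddles `θ`, which keeps `b` isometric and order-reversing on each floor. -/
theorem altWord_scale_isLow {y : CutCircle (gauss θ)} {u : Fin 2} (hy : y ∈ baseZero (gauss θ) u)
    {k : ℕ} (hk : k < rkHeight θ u) : (op (altWord k) • scale θ y).IsLow ↔ k = 0 := by
  constructor
  · intro h
    obtain ⟨z, hz⟩ := h.exists_scale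
    obtain ⟨v, hv⟩ := exists_mem_baseZero z
    refine (altWord_scale_unique hy hv hk (rkHeight_pos θ v) (l := 0) ?_).2
    rw [← hz]
    exact (op_one_smul _).symm
  · rintro rfl
    show (op (1 : DInf) • scale θ y).IsLow
    rw [op_one_smul]
    exact scale_isLow y

/-! ### Metric, order and topology of the floors -/

/-- The generators are isometries on positions, on each side of `θ`. -/
theorem abs_smul_pos_sub {x y : CutCircle θ} {s : DInf} (hs : s ∈ ({genA, genB} : Set DInf))
    (h : s = genB → (x.IsLow ↔ y.IsLow)) :
    |(op s • x).pos - (op s • y).pos| = |x.pos - y.pos| := by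
  rcases hs with rfl | rfl
  · rw [op_genA_smul, op_genA_smul, flipA_pos, flipA_pos, ← abs_neg]
    congr 1
    ring
  · have h := h rfl
    rw [op_genB_smul, op_genB_smul, ← abs_neg]
    congr 1
    by_cases hl : x.IsLow
    · rw [(flipB_of_isLow hl).1, (flipB_of_isLow (h.mp hl)).1]; ring
    · rw [(flipB_of_not_isLow hl).1, (flipB_of_not_isLow (fun h' => hl (h.mpr h'))).1]; ring

theorem abs_altWord_scale_sub {y z : CutCircle (gauss θ)} {u : Fin 2}
    (hy : y ∈ baseZero (gauss θ) u) (hz : z ∈ baseZero (gauss θ) u) {k : ℕ}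
    (hk : k < rkHeight θ u) :
    |(op (altWord k) • scale θ y).pos - (op (altWord k) • scale θ z).pos| =
      θ.1 * |y.pos - z.pos| := by
  induction k with
  | zero =>
    show |(op (1 : DInf) • scale θ y).pos - (op (1 : DInf) • scale θ z).pos| = _
    rw [op_one_smul, op_one_smul, scale_pos, scale_pos, ← mul_sub, abs_mul,
      abs_of_pos θ.2.2.1]
  | succ k ih =>
    rw [← ih (by omega), altWord_succ, smul_mul, smul_mul]
    refine abs_smul_pos_sub (altLetter_mem k) fun _ => ?_
    rw [altWord_scale_isLow hy (by omega), altWord_scale_isLow hz (by omega)]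

/-- Generators are involutions, so a point between two images is pulled back by the same generator.
For `b` the set must avoid straddling `θ`; the intermediate point is then on the same side as both
ends. -/
theorem ordConnected_image_smul {C : Set (CutCircle θ)} (hC : C.OrdConnected) {s : DInf}
    (hs : s ∈ ({genA, genB} : Set DInf))
    (h : s = genB → ∀ x ∈ C, ∀ y ∈ C, (x.IsLow ↔ y.IsLow)) :
    ((fun x => op s • x) '' C).OrdConnected := by
  refine ⟨?_⟩
  rintro _ ⟨x, hx, rfl⟩ _ ⟨y, hy, rfl⟩ z ⟨hz1, hz2⟩
  refine ⟨op s • z, ?_, ?_⟩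
  · rcases hs with rfl | rfl
    · simp only [op_genA_smul] at hz1 hz2 ⊢
      refine hC.out hy hx ⟨?_, ?_⟩
      · rwa [← flipA_le_flipA, flipA_involutive]
      · rwa [← flipA_le_flipA, flipA_involutive]
    · simp only [op_genB_smul] at hz1 hz2 ⊢
      have hxy := h rfl x hx y hy
      have hzx : z.flipB.IsLow ↔ x.IsLow := by
        rw [flipB_isLow]
        constructor
        · intro hz
          exact x.flipB_isLow.mp (IsLow.mono hz hz1)
        · intro hx
          exact IsLow.mono (y.flipB_isLow.mpr (hxy.mp hx)) hz2
      refine hC.out hy hx ⟨?_, ?_⟩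
      · rwa [← flipB_le_flipB (hzx.trans hxy), flipB_involutive]
      · rwa [← flipB_le_flipB hzx.symm, flipB_involutive]
  · show op s • op s • z = z
    rw [← smul_mul]
    rcases hs with rfl | rfl
    · rw [genA_mul_self, op_one_smul]
    · rw [genB_mul_self, op_one_smul]

theorem ordConnected_image_scale {C : Set (CutCircle (gauss θ))} (hC : C.OrdConnected) :
    (scale θ '' C).OrdConnected := by
  refine ⟨?_⟩
  rintro _ ⟨x, hx, rfl⟩ _ ⟨y, hy, rfl⟩ z ⟨hz1, hz2⟩
  obtain ⟨w, rfl⟩ := (IsLow.mono (scale_isLow y) hz2).exists_scale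
  exact ⟨w, hC.out hx hy ⟨scale_le_scale.mp hz1, scale_le_scale.mp hz2⟩, rfl⟩

theorem ordConnected_image_altWord_scale {C : Set (CutCircle (gauss θ))} (hC : C.OrdConnected)
    {u : Fin 2} (hu : C ⊆ baseZero (gauss θ) u) {k : ℕ} (hk : k < rkHeight θ u) :
    ((fun y => op (altWord k) • scale θ y) '' C).OrdConnected := by
  induction k with
  | zero =>
    have : (fun y => op (altWord 0) • scale θ y) = scale θ := by
      ext y
      exact op_one_smul _
    rw [this]
    exact ordConnected_image_scale hC
  | succ k ih =>
    have := ordConnected_image_smul (ih (by omega)) (altLetter_mem k) (by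
      rintro - _ ⟨x, hx, rfl⟩ _ ⟨y, hy, rfl⟩
      simp only
      rw [altWord_scale_isLow (hu hx) (by omega), altWord_scale_isLow (hu hy) (by omega)])
    rw [image_image] at this
    simp_rw [altWord_succ, smul_mul]
    exact this

theorem isClopenEmbedding_scale : IsOpenEmbedding (scale θ) ∧ IsClosedEmbedding (scale θ) := by
  have hm : StrictMono (scale θ) := by
    intro y z h
    rw [← not_le] at h ⊢
    rwa [scale_le_scale]
  have hr : (range (scale θ)).OrdConnected := by
    rw [range_scale]
    exact ⟨fun p _ q hq z hz => IsLow.mono hq hz.2⟩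
  have he := hm.isEmbedding_of_ordConnected hr
  refine ⟨⟨he, ?_⟩, ⟨he, ?_⟩⟩
  · rw [range_scale]; exact isClopen_isLow.2
  · rw [range_scale]; exact isClopen_isLow.1

theorem isClopen_image_scale {C : Set (CutCircle (gauss θ))} (hC : IsClopen C) :
    IsClopen (scale θ '' C) :=
  ⟨isClopenEmbedding_scale.2.isClosedMap _ hC.1, isClopenEmbedding_scale.1.isOpenMap _ hC.2⟩

theorem isClopen_image_smul {C : Set (CutCircle θ)} (hC : IsClopen C) (g : DInf) :
    IsClopen ((fun x => op g • x) '' C) :=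
  ⟨(Homeomorph.smul (op g)).isClosedMap _ hC.1, (Homeomorph.smul (op g)).isOpenMap _ hC.2⟩

end CutCircle

open CutCircle

/-! ### Invariants of the towers -/

/-- The product `θ_0 ⋯ θ_{n-1}`. -/
noncomputable def thetaProd : ℕ → IrrUnit → ℝ
  | 0, _ => 1
  | n + 1, θ => θ.1 * thetaProd n (gauss θ)

theorem thetaProd_nonneg (n : ℕ) : ∀ θ, 0 ≤ thetaProd n θ := by
  induction n with
  | zero => intro θ; exact zero_le_one
  | succ n ih => intro θ; exact mul_nonneg θ.2.2.1.le (ih _)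

/-- The product is at most `θ`, and equals `1 - rθ ≤ 1 - θ`. Pairs of factors are needed, since a
single `θ_n` may be close to `1`. -/
theorem mul_gauss_le_half (θ : IrrUnit) : θ.1 * (gauss θ).1 ≤ 1 / 2 := by
  have h := mul_gauss θ
  have h1 : (1 : ℝ) ≤ cfDigit θ := by exact_mod_cast cfDigit_pos θ
  have h2 := θ.2.2.1
  have h3 := (gauss θ).2.2.2
  nlinarith

theorem thetaProd_le (n : ℕ) :
    ∀ θ, thetaProd (2 * n) θ ≤ (1 / 2) ^ n ∧ thetaProd (2 * n + 1) θ ≤ (1 / 2) ^ n := by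
  induction n with
  | zero =>
    intro θ
    refine ⟨by simp [thetaProd], ?_⟩
    simp only [thetaProd, mul_one, pow_zero]
    exact θ.2.2.2.le
  | succ n ih =>
    intro θ
    have e : ∀ m, thetaProd (m + 2) θ = θ.1 * (gauss θ).1 * thetaProd m (gauss (gauss θ)) :=
      fun m => (mul_assoc _ _ _).symm
    obtain ⟨h1, h2⟩ := ih (gauss (gauss θ))
    have h0 := mul_gauss_le_half θ
    have h4 : ∀ m, thetaProd m (gauss (gauss θ)) ≤ (1 / 2) ^ n →
        thetaProd (m + 2) θ ≤ (1 / 2) ^ (n + 1) := by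
      intro m hm
      rw [e, pow_succ']
      exact mul_le_mul h0 hm (thetaProd_nonneg _ _) (by norm_num)
    exact ⟨h4 _ h1, h4 _ h2⟩

theorem tendsto_thetaProd (θ : IrrUnit) : Tendsto (fun n => thetaProd n θ) atTop (𝓝 0) := by
  have h : Tendsto (fun n : ℕ => ((1 : ℝ) / 2) ^ (n / 2)) atTop (𝓝 0) :=
    (tendsto_pow_atTop_nhds_zero_of_lt_one (by norm_num) (by norm_num)).comp
      (Nat.tendsto_div_const_atTop (by norm_num))
  refine squeeze_zero (fun n => thetaProd_nonneg n θ) (fun n => ?_) h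
  rcases Nat.even_or_odd' n with ⟨m, rfl | rfl⟩
  · have : 2 * m / 2 = m := by omega
    rw [this]
    exact (thetaProd_le m θ).1
  · have : (2 * m + 1) / 2 = m := by omega
    rw [this]
    exact (thetaProd_le m θ).2

/-- Each base contains a cut point. -/
theorem exists_cut_mem_base (n : ℕ) :
    ∀ (θ : IrrUnit) (v : Fin 2), ∃ x ∈ (dihedralRK n θ).base v, x.side ≠ 0 := by
  induction n with
  | zero => intro θ v; exact exists_cut_mem_baseZero v
  | succ n ih =>
    intro θ v
    obtain ⟨y, hy, h⟩ := ih (gauss θ) v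
    exact ⟨scale θ y, ⟨y, hy, rfl⟩, h⟩

theorem exists_cut_mem_floor (n : ℕ) (θ : IrrUnit) (v : Fin 2) (g : DInf) :
    ∃ x ∈ (dihedralRK n θ).floor v g, x.side ≠ 0 := by
  obtain ⟨x, hx, h⟩ := exists_cut_mem_base n θ v
  exact ⟨op g • x, ⟨x, hx, rfl⟩, fun h' => h ((smul_side_eq_zero g x).mp h')⟩

theorem RKSet.floor_mul {ι G X : Type} [Group G] [MulAction Gᵐᵒᵖ X] (A : RKSet ι G X) (v : ι)
    (g h : G) : A.floor v (g * h) = (fun x => op h • x) '' A.floor v g := by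
  unfold RKSet.floor
  rw [image_image]
  simp_rw [op_mul, mul_smul]

theorem RKSet.floor_one {ι G X : Type} [Group G] [MulAction Gᵐᵒᵖ X] (A : RKSet ι G X) (v : ι) :
    A.floor v 1 = A.base v := by
  unfold RKSet.floor
  simp

/-- On the image of the base of the tower `v` under the similarity, `h` acts as `g'` acts on the
base. -/
def IsLift (n : ℕ) (θ : IrrUnit) (v : Fin 2) (g' h : DInf) : Prop :=
  ∀ y ∈ (dihedralRK n (gauss θ)).base v, op h • scale θ y = scale θ (op g' • y)

/-! ### Lifting group elements and towers through the similarity -/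

section Towers

variable {n : ℕ} {θ : IrrUnit} {u v w : Fin 2} {g g' h h' : DInf}

theorem base_succ (n : ℕ) (θ : IrrUnit) (v : Fin 2) :
    (dihedralRK (n + 1) θ).base v = scale θ '' (dihedralRK n (gauss θ)).base v := rfl

theorem mem_elts_succ : g ∈ (dihedralRK (n + 1) θ).elts v ↔
    ∃ g' ∈ (dihedralRK n (gauss θ)).elts v, ∃ h, ∃ u, ∃ k < rkHeight θ u, IsLift n θ v g' h ∧
      (dihedralRK n (gauss θ)).floor v g' ⊆ baseZero (gauss θ) u ∧ g = h * altWord k := Iff.rfl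

/-- Each base contains a cut point, and its image under an element determines the element. -/
theorem IsLift.unique (h1 : IsLift n θ v g' h) (h2 : IsLift n θ v g' h') : h = h' := by
  obtain ⟨y, hy, hs⟩ := exists_cut_mem_base n (gauss θ) v
  refine eq_of_smul_eq (p := scale θ y) hs ?_
  rw [h1 y hy, h2 y hy]

theorem IsLift.unique_left (h1 : IsLift n θ v g h) (h2 : IsLift n θ v g' h) : g = g' := by
  obtain ⟨y, hy, hs⟩ := exists_cut_mem_base n (gauss θ) v
  refine eq_of_smul_eq hs ?_
  apply scale_injective
  rw [← h1 y hy, ← h2 y hy]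

theorem isLift_one : IsLift n θ v 1 1 := fun y _ => by rw [op_one_smul, op_one_smul]

theorem IsLift.mul_genA (h1 : IsLift n θ v g' h) : IsLift n θ v (g' * genA) (h * genB) := by
  intro y hy
  rw [smul_mul, smul_mul, h1 y hy, scale_smul_genA]

theorem IsLift.mul_genB (h1 : IsLift n θ v g' h)
    (hu : (dihedralRK n (gauss θ)).floor v g' ⊆ baseZero (gauss θ) u) :
    IsLift n θ v (g' * genB) (h * reflec (1 - (rkHeight θ u : ℤ))) := by
  intro y hy
  rw [smul_mul, smul_mul, h1 y hy, scale_smul_genB (hu ⟨y, hy, rfl⟩)]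

theorem IsLift.mul (h1 : IsLift n θ w g' h) {m : ℕ} {h2 g2 : DInf} (hl : IsLift m θ v g2 h2)
    (hsub : (dihedralRK n (gauss θ)).floor w g' ⊆ (dihedralRK m (gauss θ)).base v) :
    IsLift n θ w (g' * g2) (h * h2) := by
  intro y hy
  rw [smul_mul, smul_mul, h1 y hy, hl _ (hsub ⟨y, hy, rfl⟩)]

theorem IsLift.floor_eq (h1 : IsLift n θ v g' h) (k : DInf) :
    (dihedralRK (n + 1) θ).floor v (h * k) =
      (fun z => op k • scale θ z) '' (dihedralRK n (gauss θ)).floor v g' := by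
  unfold RKSet.floor
  rw [base_succ, image_image, image_image]
  refine image_congr fun y hy => ?_
  rw [smul_mul, h1 y hy]

theorem IsLift.mem_elts (h1 : IsLift n θ v g' h) (hg : g' ∈ (dihedralRK n (gauss θ)).elts v)
    (hu : (dihedralRK n (gauss θ)).floor v g' ⊆ baseZero (gauss θ) u) {k : ℕ}
    (hk : k < rkHeight θ u) : h * altWord k ∈ (dihedralRK (n + 1) θ).elts v :=
  mem_elts_succ.mpr ⟨g', hg, h, u, k, hk, h1, hu, rfl⟩

theorem IsLift.mem_elts_zero (h1 : IsLift n θ v g' h) (hg : g' ∈ (dihedralRK n (gauss θ)).elts v)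
    (hu : (dihedralRK n (gauss θ)).floor v g' ⊆ baseZero (gauss θ) u) :
    h ∈ (dihedralRK (n + 1) θ).elts v := by
  have := h1.mem_elts hg hu (rkHeight_pos θ u)
  rwa [show altWord 0 = 1 from rfl, mul_one] at this

theorem floor_mul_genB_subset (hu : (dihedralRK n θ).floor v g ⊆ baseZero θ u) :
    (dihedralRK n θ).floor v (g * genB) ⊆ baseZero θ u := by
  rw [RKSet.floor_mul]
  rintro _ ⟨x, hx, rfl⟩
  exact smul_genB_mem_baseZero.mpr (hu hx)

/-- The properties of `𝒜_n` that are preserved in the inductive construction. -/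
structure IsGood (n : ℕ) (θ : IrrUnit) : Prop where
  isRK : (dihedralRK n θ).IsRK {genA, genB}
  sub : ∀ v, ∀ g ∈ (dihedralRK n θ).elts v, ∃ u, (dihedralRK n θ).floor v g ⊆ baseZero θ u
  diam : ∀ v, ∀ g ∈ (dihedralRK n θ).elts v, ∀ x ∈ (dihedralRK n θ).floor v g,
    ∀ y ∈ (dihedralRK n θ).floor v g, |x.pos - y.pos| ≤ thetaProd n θ
  exit : ∀ v, ∀ g ∈ (dihedralRK n θ).elts v, ∀ s ∈ ({genA, genB} : Set DInf),
    g * s ∈ (dihedralRK n θ).elts v ∨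
      ∀ x ∈ (dihedralRK n θ).floor v g, |(op s • x).pos - x.pos| ≤ thetaProd n θ

/-- The step relation in the tower `v`. -/
def TowerStep (n : ℕ) (θ : IrrUnit) (v : Fin 2) (g h : DInf) : Prop :=
  h ∈ (dihedralRK n θ).elts v ∧ ∃ s ∈ ({genA, genB} : Set DInf), h = g * s

theorem IsLift.reach (h1 : IsLift n θ v g' h) (hg : g' ∈ (dihedralRK n (gauss θ)).elts v)
    (hu : (dihedralRK n (gauss θ)).floor v g' ⊆ baseZero (gauss θ) u) {k : ℕ}
    (hk : k < rkHeight θ u) :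
    Relation.ReflTransGen (TowerStep (n + 1) θ v) h (h * altWord k) ∧
    Relation.ReflTransGen (TowerStep (n + 1) θ v) (h * altWord k) h := by
  induction k with
  | zero => rw [show altWord 0 = 1 from rfl, mul_one]; exact ⟨.refl, .refl⟩
  | succ k ih =>
    obtain ⟨i1, i2⟩ := ih (by omega)
    refine ⟨i1.tail ⟨h1.mem_elts hg hu hk, _, altLetter_mem k, ?_⟩,
      i2.head ⟨h1.mem_elts hg hu (by omega), _, altLetter_mem k, ?_⟩⟩
    · rw [altWord_succ, mul_assoc]
    · rw [mul_assoc, altWord_succ_mul_altLetter]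

/-- Applying the next letter on the top floor of a column amounts to applying the image of `b` in
the base and then climbing to the top. Columns are therefore joined at the top by `b` of the small
circle. -/
theorem altWord_top_mul_altLetter (θ : IrrUnit) (u : Fin 2) :
    altWord (rkHeight θ u - 1) * altLetter (rkHeight θ u - 1) =
      reflec (1 - (rkHeight θ u : ℤ)) * altWord (rkHeight θ u - 1) := by
  rw [altWord_mul_altLetter]
  congr 2
  have := rkHeight_pos θ u
  omega

/-- Each move in a tower lifts, and the lift is reached within the lifted tower. -/
theorem IsGood.exists_lift (G : IsGood n (gauss θ))
    (hg : g' ∈ (dihedralRK n (gauss θ)).elts v) :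
    ∃ h, IsLift n θ v g' h ∧ Relation.ReflTransGen (TowerStep (n + 1) θ v) 1 h := by
  have key : ∀ g', Relation.ReflTransGen (TowerStep n (gauss θ) v) 1 g' →
      g' ∈ (dihedralRK n (gauss θ)).elts v ∧
      ∃ h, IsLift n θ v g' h ∧ Relation.ReflTransGen (TowerStep (n + 1) θ v) 1 h := by
    intro g' hg'
    induction hg' with
    | refl => exact ⟨G.isRK.one_mem v, 1, isLift_one, .refl⟩
    | tail _ hstep ih =>
      obtain ⟨hb, h, hl, hr⟩ := ih
      obtain ⟨hc, s, hs, rfl⟩ := hstep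
      refine ⟨hc, ?_⟩
      obtain ⟨u, hu⟩ := G.sub v _ hb
      obtain ⟨u', hu'⟩ := G.sub v _ hc
      rcases hs with rfl | rfl
      -- The letter `a` of the small circle is the single letter `b`, between two bottom floors.
      · exact ⟨_, hl.mul_genA, hr.tail ⟨hl.mul_genA.mem_elts_zero hc hu', genB, by simp, rfl⟩⟩
      · have hl2 := hl.mul_genB hu
        have hu2 := floor_mul_genB_subset hu
        have hk : rkHeight θ u - 1 < rkHeight θ u := by
          have := rkHeight_pos θ u
          omega
        -- The letter `b` lifts to a longer walk: climb the column, cross at the top by one letter,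
        -- descend the neighbouring column.
        refine ⟨_, hl2, ((hr.trans (hl.reach hb hu hk).1).tail ?_).trans
          (hl2.reach hc hu2 hk).2⟩
        refine ⟨hl2.mem_elts hc hu2 hk, _, altLetter_mem (rkHeight θ u - 1), ?_⟩
        rw [mul_assoc, mul_assoc, altWord_top_mul_altLetter]
  exact (key g' (G.isRK.moved v g' hg)).2

theorem isGood_zero (θ : IrrUnit) : IsGood 0 θ := by
  have hf : ∀ v, ∀ g ∈ (dihedralRK 0 θ).elts v, (dihedralRK 0 θ).floor v g = baseZero θ v := by
    rintro v g rfl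
    exact RKSet.floor_one _ v
  refine ⟨⟨fun v => rfl, fun v => finite_singleton _, fun v => ?_, fun v g hg => ?_,
    fun v g hg => ?_, ?_, fun v w g hg h hh hne => ?_, fun x => ?_⟩, fun v g hg => ?_, ?_, ?_⟩
  · obtain ⟨x, hx, -⟩ := exists_cut_mem_base 0 θ v
    exact ⟨x, hx⟩
  · rw [hf v g hg]; exact isClopen_baseZero v
  · rw [hf v g hg]; exact ordConnected_baseZero v
  · rintro v g rfl
    exact .refl
  · rw [hf v g hg, hf w h hh, disjoint_left]
    intro x hx hx'
    obtain rfl := baseZero_unique hx hx'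
    apply hne
    rw [show g = 1 from hg, show h = 1 from hh]
  · obtain ⟨u, hu⟩ := exists_mem_baseZero x
    exact ⟨u, 1, rfl, by rwa [hf u 1 rfl]⟩
  · exact ⟨v, (hf v g hg).le⟩
  · intro v g _ x _ y _
    show _ ≤ (1 : ℝ)
    rw [abs_le]
    constructor <;> linarith [x.pos_nonneg, x.pos_le_one, y.pos_nonneg, y.pos_le_one]
  · intro v g _ s _
    right
    intro x _
    show _ ≤ (1 : ℝ)
    rw [abs_le]
    constructor <;>
      linarith [x.pos_nonneg, x.pos_le_one, (op s • x).pos_nonneg, (op s • x).pos_le_one]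

/-- Every floor of the new towers is a floor of the old ones, scaled and moved along a column.
Scaling multiplies the metric bounds by `θ`, and moving along a column is isometric. A generator can
leave a new tower only at the top or bottom of a column, where it acts as a generator leaving the
old tower. -/
theorem IsGood.succ (G : IsGood n (gauss θ)) : IsGood (n + 1) θ := by
  refine ⟨⟨fun v => ?_, fun v => ?_, fun v => ?_, fun v g hg => ?_,
    fun v g hg => ?_, fun v g hg => ?_, fun v w g hg h hh hne => ?_, fun x => ?_⟩,
    fun v g hg => ?_, fun v g hg => ?_, fun v g hg s hs => ?_⟩
  · obtain ⟨u, hu⟩ := G.sub v 1 (G.isRK.one_mem v)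
    exact isLift_one.mem_elts_zero (G.isRK.one_mem v) hu
  · have : ∀ g' : (dihedralRK n (gauss θ)).elts v, ∃ h, IsLift n θ v g'.1 h := fun g' => by
      obtain ⟨h, hl, -⟩ := G.exists_lift g'.2
      exact ⟨h, hl⟩
    choose f hf using this
    have := (G.isRK.finite v).to_subtype
    -- Lifts are unique, so an element is determined by `g'` and `k`; `r + 1` bounds both heights.
    refine (Set.finite_range fun p : (dihedralRK n (gauss θ)).elts v × Fin (cfDigit θ + 1) =>
      f p.1 * altWord p.2).subset ?_
    rintro g ⟨g', hg', h, u, k, hk, hl, hu, rfl⟩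
    refine ⟨(⟨g', hg'⟩, ⟨k, ?_⟩), ?_⟩
    · unfold rkHeight at hk
      split_ifs at hk <;> omega
    · show f ⟨g', hg'⟩ * altWord k = h * altWord k
      rw [IsLift.unique (hf ⟨g', hg'⟩) hl]
  · obtain ⟨x, hx, -⟩ := exists_cut_mem_base (n + 1) θ v
    exact ⟨x, hx⟩
  · obtain ⟨g', hg', h, u, k, hk, hl, hu, rfl⟩ := mem_elts_succ.mp hg
    rw [hl.floor_eq, ← image_image (fun x => op (altWord k) • x)]
    exact isClopen_image_smul (isClopen_image_scale (G.isRK.clopen v g' hg')) _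
  · obtain ⟨g', hg', h, u, k, hk, hl, hu, rfl⟩ := mem_elts_succ.mp hg
    rw [hl.floor_eq]
    exact ordConnected_image_altWord_scale (G.isRK.interval v g' hg') hu hk
  · obtain ⟨g', hg', h, u, k, hk, hl, hu, rfl⟩ := mem_elts_succ.mp hg
    obtain ⟨h', hl', hr⟩ := G.exists_lift hg'
    obtain rfl := hl.unique hl'
    exact hr.trans (hl.reach hg' hu hk).1
  · obtain ⟨g1, hg1, h1, u1, k1, hk1, hl1, hu1, rfl⟩ := mem_elts_succ.mp hg
    obtain ⟨g2, hg2, h2, u2, k2, hk2, hl2, hu2, rfl⟩ := mem_elts_succ.mp hh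
    rw [hl1.floor_eq, hl2.floor_eq, disjoint_left]
    rintro _ ⟨y, hy, rfl⟩ ⟨z, hz, e⟩
    obtain ⟨rfl, rfl⟩ := altWord_scale_unique (hu2 hz) (hu1 hy) hk2 hk1 e
    by_cases hvg : (v, g1) = (w, g2)
    · obtain ⟨rfl, rfl⟩ := Prod.mk.inj hvg
      obtain rfl := hl1.unique hl2
      exact hne rfl
    · exact disjoint_left.mp (G.isRK.disjoint v w g1 hg1 g2 hg2 hvg) hy hz
  · obtain ⟨u, y, k, hy, hk, rfl⟩ := exists_altWord_scale x
    obtain ⟨v, g', hg', hyv⟩ := G.isRK.cover y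
    obtain ⟨u', hu'⟩ := G.sub v g' hg'
    obtain rfl := baseZero_unique hy (hu' hyv)
    obtain ⟨h, hl, -⟩ := G.exists_lift hg'
    refine ⟨v, _, hl.mem_elts hg' hu' hk, ?_⟩
    rw [hl.floor_eq]
    exact ⟨y, hyv, rfl⟩
  · obtain ⟨g', hg', h, u, k, hk, hl, hu, rfl⟩ := mem_elts_succ.mp hg
    rw [hl.floor_eq]
    by_cases h0 : k = 0
    · refine ⟨0, ?_⟩
      rintro _ ⟨y, hy, rfl⟩
      exact (mem_baseZero_zero _).mpr ((altWord_scale_isLow (hu hy) hk).mpr h0)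
    · refine ⟨1, ?_⟩
      rintro _ ⟨y, hy, rfl⟩
      exact (mem_baseZero_one _).mpr fun h' => h0 ((altWord_scale_isLow (hu hy) hk).mp h')
  · obtain ⟨g', hg', h, u, k, hk, hl, hu, rfl⟩ := mem_elts_succ.mp hg
    rw [hl.floor_eq]
    rintro _ ⟨y, hy, rfl⟩ _ ⟨z, hz, rfl⟩
    show |(op (altWord k) • scale θ y).pos - (op (altWord k) • scale θ z).pos| ≤ _
    rw [abs_altWord_scale_sub (hu hy) (hu hz) hk]
    exact mul_le_mul_of_nonneg_left (G.diam v g' hg' y hy z hz) θ.2.2.1.le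
  · obtain ⟨g', hg', h, u, k, hk, hl, hu, rfl⟩ := mem_elts_succ.mp hg
    rcases eq_altLetter_of_mem hs k with rfl | rfl
    · rcases Nat.lt_or_ge (k + 1) (rkHeight θ u) with hk' | hk'
      · left
        rw [mul_assoc, ← altWord_succ]
        exact hl.mem_elts hg' hu hk'
      · obtain rfl : k = rkHeight θ u - 1 := by omega
        -- Crossing at the top of a column is `b` on the small circle.
        rcases G.exit v g' hg' genB (by simp) with h1 | h1
        · left
          rw [mul_assoc, altWord_top_mul_altLetter, ← mul_assoc]
          exact (hl.mul_genB hu).mem_elts h1 (floor_mul_genB_subset hu) hk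
        · right
          rw [hl.floor_eq]
          rintro _ ⟨y, hy, rfl⟩
          simp only
          rw [← smul_mul, altWord_top_mul_altLetter, smul_mul, ← scale_smul_genB (hu hy),
            abs_altWord_scale_sub (smul_genB_mem_baseZero.mpr (hu hy)) (hu hy) hk]
          exact mul_le_mul_of_nonneg_left (h1 y hy) θ.2.2.1.le
    · rcases k with _ | j
      -- At the bottom the other generator is `b`, which is `a` on the small circle.
      · have e : altLetter (0 + 1) = genB := rfl
        rw [e, show altWord 0 = 1 from rfl, mul_one]
        rcases G.exit v g' hg' genA (by simp) with h1 | h1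
        · left
          obtain ⟨u', hu'⟩ := G.sub v _ h1
          exact hl.mul_genA.mem_elts_zero h1 hu'
        · right
          have := hl.floor_eq 1
          rw [mul_one] at this
          rw [this]
          rintro _ ⟨y, hy, rfl⟩
          simp only
          rw [op_one_smul, ← scale_smul_genA, scale_pos, scale_pos, ← mul_sub, abs_mul,
            abs_of_pos θ.2.2.1]
          exact mul_le_mul_of_nonneg_left (h1 y hy) θ.2.2.1.le
      · left
        have e : altLetter (j + 1 + 1) = altLetter j := by
          unfold altLetter
          simp [Nat.even_add_one]
        rw [e, mul_assoc, altWord_succ_mul_altLetter]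
        exact hl.mem_elts hg' hu (by omega)

theorem isGood (n : ℕ) : ∀ θ, IsGood n θ := by
  induction n with
  | zero => exact isGood_zero
  | succ n ih => exact fun θ => (ih (gauss θ)).succ

theorem floor_nonempty (n : ℕ) (θ : IrrUnit) (v : Fin 2) (g : DInf) :
    ((dihedralRK n θ).floor v g).Nonempty := by
  obtain ⟨x, hx, -⟩ := exists_cut_mem_floor n θ v g
  exact ⟨x, hx⟩

/-- An element of the tower `v` of `𝒜_{n+1}` lies in `[0, θ]` only if it is the image of an element
of a tower of `𝒜_n`. -/
theorem exists_isLift_of_floor_subset (hg : g ∈ (dihedralRK (n + 1) θ).elts v)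
    {C : Set (CutCircle (gauss θ))} (hC : (dihedralRK (n + 1) θ).floor v g ⊆ scale θ '' C) :
    ∃ g' ∈ (dihedralRK n (gauss θ)).elts v, IsLift n θ v g' g ∧
      (dihedralRK n (gauss θ)).floor v g' ⊆ C := by
  obtain ⟨g', hg', h, u, k, hk, hl, hu, rfl⟩ := mem_elts_succ.mp hg
  rw [hl.floor_eq] at hC
  have hk0 : k = 0 := by
    obtain ⟨y, hy⟩ := floor_nonempty n (gauss θ) v g'
    obtain ⟨z, -, hz⟩ := hC ⟨y, hy, rfl⟩
    have hz' : scale θ z = op (altWord k) • scale θ y := hz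
    rw [← altWord_scale_isLow (hu hy) hk, ← hz']
    exact scale_isLow z
  subst hk0
  rw [show altWord 0 = 1 from rfl] at hC ⊢
  rw [mul_one]
  refine ⟨g', hg', hl, fun y hy => ?_⟩
  obtain ⟨z, hz, e⟩ := hC ⟨y, hy, rfl⟩
  simp only [op_one_smul] at e
  rwa [← scale_injective e]

theorem IsLift.floor_subset_iff (hl : IsLift n θ v g' g) {C : Set (CutCircle (gauss θ))} :
    (dihedralRK (n + 1) θ).floor v g ⊆ scale θ '' C ↔
      (dihedralRK n (gauss θ)).floor v g' ⊆ C := by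
  have := hl.floor_eq 1
  rw [mul_one] at this
  rw [this]
  simp_rw [op_one_smul]
  exact image_subset_image_iff scale_injective

/-- A factorization on the small circle lifts factor by factor, with the alternating word attached
to the second factor. Conversely, a new floor inside a new base lies in `[0, θ]`, hence is a bottom
floor and comes from the small circle. -/
theorem refines (n : ℕ) : ∀ θ, (dihedralRK n θ).Refines (dihedralRK (n + 1) θ) := by
  induction n with
  | zero =>
    intro θ v k
    constructor
    · intro hk
      obtain ⟨u, hu⟩ := (isGood 1 θ).sub v k hk
      exact ⟨u, 1, rfl, k, hk, hu, (mul_one k).symm⟩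
    · rintro ⟨u, g, rfl, h, hh, -, rfl⟩
      rwa [mul_one]
  | succ n ih =>
    intro θ v k
    constructor
    · intro hk
      obtain ⟨g', hg', h, u0, i, hi, hl, hu0, rfl⟩ := mem_elts_succ.mp hk
      obtain ⟨u, g1, hg1, h1, hh1, hsub, rfl⟩ := (ih (gauss θ) v g').mp hg'
      obtain ⟨H, hH, -⟩ := (isGood (n + 1) (gauss θ)).exists_lift hh1
      obtain ⟨K, hK, -⟩ := (isGood n (gauss θ)).exists_lift hg1
      obtain rfl := hl.unique (hH.mul hK hsub)
      obtain ⟨u1, hu1⟩ := (isGood n (gauss θ)).sub u g1 hg1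
      obtain ⟨u2, hu2⟩ := (isGood (n + 1) (gauss θ)).sub v h1 hh1
      -- One common point shows that the coarse and the fine floor lie over the same interval, so
      -- that the same column height applies to both.
      obtain ⟨y, hy⟩ := floor_nonempty (n + 1) (gauss θ) v (h1 * g1)
      have hy' := hy
      rw [RKSet.floor_mul] at hy'
      obtain ⟨z, hz, rfl⟩ := hy'
      obtain rfl := baseZero_unique (hu0 hy) (hu1 ⟨z, hsub hz, rfl⟩)
      exact ⟨u, K * altWord i, hK.mem_elts hg1 hu1 hi, H, hH.mem_elts_zero hh1 hu2,
        hH.floor_subset_iff.mpr hsub, mul_assoc _ _ _⟩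
    · rintro ⟨u, g, hg, h, hh, hsub, rfl⟩
      obtain ⟨g1, hg1, K, u0, i, hi, hK, hu0, rfl⟩ := mem_elts_succ.mp hg
      obtain ⟨h1, hh1, hH, hsub'⟩ := exists_isLift_of_floor_subset hh hsub
      rw [← mul_assoc]
      refine (hH.mul hK hsub').mem_elts ((ih (gauss θ) v _).mpr ⟨u, g1, hg1, h1, hh1, hsub', rfl⟩)
        ?_ hi
      rw [RKSet.floor_mul]
      rintro _ ⟨y, hy, rfl⟩
      exact hu0 ⟨y, hsub' hy, rfl⟩

/-! ### Multiplicities of the edges -/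

/-- The elements of the tower `v` of `𝒜_{n+1}` in the base of the tower `u` of `𝒜_n`. -/
def edgeElts (n : ℕ) (θ : IrrUnit) (u v : Fin 2) : Set DInf :=
  {g ∈ (dihedralRK (n + 1) θ).elts v |
    (dihedralRK (n + 1) θ).floor v g ⊆ (dihedralRK n θ).base u}

theorem mult_eq_ncard (n : ℕ) (θ : IrrUnit) (u v : Fin 2) :
    (dihedralDiagram θ).mult n u v = (edgeElts n θ u v).ncard := by
  refine Nat.card_congr ⟨fun e => ⟨RKEdge.elt e.1, ?_⟩,
    fun g => ⟨(⟨u, v, g.1, g.2.1, g.2.2⟩ : RKEdge (dihedralRK n θ) (dihedralRK (n + 1) θ)),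
      rfl, rfl⟩, ?_, fun _ => rfl⟩
  · obtain ⟨e, rfl, rfl⟩ := e
    exact ⟨RKEdge.mem e, RKEdge.sub e⟩
  · rintro ⟨e, rfl, rfl⟩
    rfl

/-- Lifting is a bijection between these sets, since floors inside a base are bottom floors. -/
theorem edgeElts_succ_ncard (n : ℕ) (θ : IrrUnit) (u v : Fin 2) :
    (edgeElts (n + 1) θ u v).ncard = (edgeElts n (gauss θ) u v).ncard := by
  have hex : ∀ g' ∈ edgeElts n (gauss θ) u v, ∃ h, IsLift (n + 1) θ v g' h := by
    intro g' hg'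
    obtain ⟨h, hl, -⟩ := (isGood (n + 1) (gauss θ)).exists_lift hg'.1
    exact ⟨h, hl⟩
  choose! f hf using hex
  symm
  refine Set.ncard_congr (fun g _ => f g) (fun g hg => ?_) (fun g g' hg hg' e => ?_)
    (fun h hh => ?_)
  · obtain ⟨u', hu'⟩ := (isGood (n + 1) (gauss θ)).sub v g hg.1
    exact ⟨(hf g hg).mem_elts_zero hg.1 hu', (hf g hg).floor_subset_iff.mpr hg.2⟩
  · have h1 := hf g hg
    rw [show f g = f g' from e] at h1
    exact h1.unique_left (hf g' hg')
  · obtain ⟨g', hg', hl, hsub⟩ := exists_isLift_of_floor_subset hh.1 hh.2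
    exact ⟨g', ⟨hg', hsub⟩, (hf g' ⟨hg', hsub⟩).unique hl⟩

theorem floor_zero_one (θ : IrrUnit) (v : Fin 2) :
    (dihedralRK 0 θ).floor v 1 = baseZero θ v := RKSet.floor_one _ v

theorem elts_one (θ : IrrUnit) (v : Fin 2) :
    (dihedralRK 1 θ).elts v = altWord '' Iio (rkHeight θ v) := by
  ext g
  constructor
  · intro hg
    obtain ⟨g', rfl, h, u, k, hk, hl, hu, rfl⟩ := mem_elts_succ.mp hg
    obtain rfl := hl.unique (isLift_one (n := 0) (θ := θ) (v := v))
    rw [floor_zero_one] at hu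
    obtain ⟨x, hx, -⟩ := exists_cut_mem_baseZero (θ := gauss θ) v
    obtain rfl := baseZero_unique hx (hu hx)
    exact ⟨k, hk, (one_mul _).symm⟩
  · rintro ⟨k, hk, rfl⟩
    have := (isLift_one (n := 0) (θ := θ) (v := v)).mem_elts (k := k) rfl (floor_zero_one _ v).le hk
    rwa [one_mul] at this

theorem altWord_injOn (θ : IrrUnit) (v : Fin 2) : InjOn altWord (Iio (rkHeight θ v)) := by
  intro k hk l hl e
  obtain ⟨x, hx, -⟩ := exists_cut_mem_baseZero (θ := gauss θ) v
  exact (altWord_scale_unique hx hx hk hl (by rw [e])).2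

theorem floor_one_altWord_subset (θ : IrrUnit) (u v : Fin 2) {k : ℕ} (hk : k < rkHeight θ v) :
    (dihedralRK 1 θ).floor v (altWord k) ⊆ baseZero θ u ↔ (u = 0 ↔ k = 0) := by
  have hf := (isLift_one (n := 0) (θ := θ) (v := v)).floor_eq (altWord k)
  rw [one_mul, floor_zero_one] at hf
  rw [hf]
  have key : ∀ y ∈ baseZero (gauss θ) v,
      (op (altWord k) • scale θ y ∈ baseZero θ u ↔ (u = 0 ↔ k = 0)) := by
    intro y hy
    have := altWord_scale_isLow hy hk
    fin_cases u
    · simp only [Fin.zero_eta, mem_baseZero_zero, this, true_iff]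
    · simp only [Fin.mk_one, mem_baseZero_one, this, one_ne_zero, false_iff]
  constructor
  · intro h
    obtain ⟨x, hx, -⟩ := exists_cut_mem_baseZero (θ := gauss θ) v
    exact (key x hx).mp (h ⟨x, hx, rfl⟩)
  · rintro h _ ⟨y, hy, rfl⟩
    exact (key y hy).mpr h

/-- Each column has exactly its bottom floor in `[0, θ]` and the others in `[θ, 1]`. -/
theorem edgeElts_zero_ncard (θ : IrrUnit) (u v : Fin 2) :
    (edgeElts 0 θ u v).ncard = if u = 0 then 1 else rkHeight θ v - 1 := by
  have h : edgeElts 0 θ u v = altWord '' {k | k < rkHeight θ v ∧ (u = 0 ↔ k = 0)} := by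
    ext g
    constructor
    · rintro ⟨h1, h2⟩
      rw [elts_one] at h1
      obtain ⟨k, hk, rfl⟩ := h1
      exact ⟨k, ⟨hk, (floor_one_altWord_subset θ u v hk).mp h2⟩, rfl⟩
    · rintro ⟨k, ⟨hk, h⟩, rfl⟩
      refine ⟨?_, (floor_one_altWord_subset θ u v hk).mpr h⟩
      show _ ∈ (dihedralRK 1 θ).elts v
      rw [elts_one]
      exact ⟨k, hk, rfl⟩
  rw [h, ((altWord_injOn θ v).mono fun k hk => hk.1).ncard_image]
  have hp := rkHeight_pos θ v
  split_ifs with hu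
  · have : {k | k < rkHeight θ v ∧ (u = 0 ↔ k = 0)} = {0} := by
      ext k
      simp only [hu, mem_ofPred_eq, mem_singleton_iff]
      constructor
      · rintro ⟨-, h⟩; exact h.mp trivial
      · rintro rfl; exact ⟨hp, by simp⟩
    rw [this, ncard_singleton]
  · have : {k | k < rkHeight θ v ∧ (u = 0 ↔ k = 0)} = (Finset.Ico 1 (rkHeight θ v) : Set ℕ) := by
      ext k
      simp only [hu, mem_ofPred_eq, Finset.coe_Ico, mem_Ico, false_iff]
      omega
    rw [this, ncard_coe_finset, Nat.card_Ico]

theorem mult_eq (n : ℕ) : ∀ (θ : IrrUnit) (u v : Fin 2), (dihedralDiagram θ).mult n u v =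
    if u = 0 then 1 else rkHeight (gauss^[n] θ) v - 1 := by
  induction n with
  | zero => intro θ u v; rw [mult_eq_ncard, edgeElts_zero_ncard]; rfl
  | succ n ih =>
    intro θ u v
    rw [mult_eq_ncard, edgeElts_succ_ncard, ← mult_eq_ncard, ih (gauss θ) u v]
    rfl

end Towers

/-! ### The path space of a separating sequence of Rokhlin-Kakutani sets -/

section PathSpace

variable {ι : ℕ → Type} {G X : Type} [Group G] [MulAction Gᵐᵒᵖ X]

variable {A : ∀ n, RKSet (ι n) G X}

/-- The element of the tower of `𝒜_n` that is encoded by the first `n` edges of a path. -/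
def cell (γ : (rkDiagram A).Path) (n : ℕ) : Set X :=
  (A n).floor (RKEdge.src (γ.1 n)) (pathElt γ n)

theorem rng_eq_src (γ : (rkDiagram A).Path) (n : ℕ) :
    RKEdge.rng (γ.1 n) = RKEdge.src (γ.1 (n + 1)) := γ.2 n

theorem pathElt_succ (γ : (rkDiagram A).Path) (n : ℕ) :
    pathElt γ (n + 1) = RKEdge.elt (γ.1 n) * pathElt γ n := rfl

theorem pathCell_eq (γ : (rkDiagram A).Path) (n : ℕ) : pathCell γ n = cell γ (n + 1) := by
  unfold pathCell cell
  rw [rng_eq_src]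

theorem cell_succ_subset (γ : (rkDiagram A).Path) (n : ℕ) : cell γ (n + 1) ⊆ cell γ n := by
  unfold cell
  rw [← rng_eq_src, pathElt_succ, RKSet.floor_mul]
  rintro _ ⟨x, hx, rfl⟩
  exact ⟨x, RKEdge.sub (γ.1 n) hx, rfl⟩

theorem antitone_cell (γ : (rkDiagram A).Path) : Antitone (cell γ) :=
  antitone_nat_of_succ_le (cell_succ_subset γ)

/-- Common later edges multiply both elements on the left and cancel, so naturality may be tested at
any later level. -/
theorem pathElt_inv_mul_const {γ γ' : (rkDiagram A).Path} {n : ℕ}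
    (h : ∀ k, n ≤ k → γ.1 k = γ'.1 k) {m : ℕ} (hm : n ≤ m) :
    (pathElt γ m)⁻¹ * pathElt γ' m = (pathElt γ n)⁻¹ * pathElt γ' n := by
  induction m, hm using Nat.le_induction with
  | base => rfl
  | succ m hm ih => rw [pathElt_succ, pathElt_succ, h m hm, ← ih]; group

variable [TopologicalSpace X] [Preorder X]

/-- A refining sequence of Rokhlin-Kakutani sets that starts with towers of height one and
separates points. -/
structure IsRKSequence (A : ∀ n, RKSet (ι n) G X) (S : Set G) : Prop where
  isRK : ∀ n, (A n).IsRK S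
  refines : ∀ n, (A n).Refines (A (n + 1))
  elts_zero : ∀ v, ∀ g ∈ (A 0).elts v, g = 1
  separates : ∀ x y : X,
    (∀ n, ∃ v, ∃ g ∈ (A n).elts v, x ∈ (A n).floor v g ∧ y ∈ (A n).floor v g) → x = y

variable {S : Set G}

theorem RKSet.IsRK.eq_of_mem {ι : Type} {A : RKSet ι G X} (hA : A.IsRK S) {v w : ι} {g h : G}
    (hg : g ∈ A.elts v) (hh : h ∈ A.elts w) {x : X} (h1 : x ∈ A.floor v g)
    (h2 : x ∈ A.floor w h) : v = w ∧ g = h := by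
  by_contra hne
  exact disjoint_left.mp (hA.disjoint v w g hg h hh fun e => hne (Prod.mk.inj e)) h1 h2

namespace IsRKSequence

theorem pathElt_mem (hA : IsRKSequence A S) (γ : (rkDiagram A).Path) (n : ℕ) :
    pathElt γ n ∈ (A n).elts (RKEdge.src (γ.1 n)) := by
  induction n with
  | zero => exact (hA.isRK 0).one_mem _
  | succ n ih =>
    rw [← rng_eq_src]
    exact (hA.refines n _ _).mpr ⟨_, _, ih, _, RKEdge.mem (γ.1 n), RKEdge.sub (γ.1 n), rfl⟩

theorem eq_of_mem_cell (hA : IsRKSequence A S) {γ : (rkDiagram A).Path} {x y : X}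
    (hx : ∀ n, x ∈ cell γ n) (hy : ∀ n, y ∈ cell γ n) : x = y :=
  hA.separates x y fun n => ⟨_, _, hA.pathElt_mem γ n, hx n, hy n⟩

theorem exists_mem_cell [CompactSpace X] (hA : IsRKSequence A S) (γ : (rkDiagram A).Path) :
    ∃ x, ∀ n, x ∈ cell γ n := by
  have hcl : ∀ n, IsClosed (cell γ n) := fun n => ((hA.isRK n).clopen _ _ (hA.pathElt_mem γ n)).1
  have := IsCompact.nonempty_iInter_of_sequence_nonempty_isCompact_isClosed (cell γ)
    (cell_succ_subset γ) (fun n => ((hA.isRK n).nonempty _).image _) (hcl 0).isCompact hcl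
  obtain ⟨x, hx⟩ := this
  exact ⟨x, fun n => mem_iInter.mp hx n⟩

/-- A nonempty floor lies in at most one of the disjoint bases, so the source is redundant. -/
theorem edge_ext (hA : IsRKSequence A S) {n : ℕ} {e e' : RKEdge (A n) (A (n + 1))}
    (h1 : e.rng = e'.rng) (h2 : e.elt = e'.elt) : e = e' := by
  obtain ⟨u, v, g, hm, hs⟩ := e
  obtain ⟨u', v', g', hm', hs'⟩ := e'
  obtain rfl : v = v' := h1
  obtain rfl : g = g' := h2
  obtain ⟨x, hx⟩ := ((hA.isRK (n + 1)).nonempty v).image (fun x => op g • x)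
  have e1 := hs hx
  have e2 := hs' hx
  rw [← RKSet.floor_one] at e1 e2
  obtain ⟨rfl, -⟩ := (hA.isRK n).eq_of_mem ((hA.isRK n).one_mem u) ((hA.isRK n).one_mem u') e1 e2
  rfl

theorem path_eq_of_mem_cell (hA : IsRKSequence A S) {γ γ' : (rkDiagram A).Path} {x : X}
    (h : ∀ n, x ∈ cell γ n) (h' : ∀ n, x ∈ cell γ' n) : γ = γ' := by
  have key : ∀ n, RKEdge.src (γ.1 n) = RKEdge.src (γ'.1 n) ∧ pathElt γ n = pathElt γ' n :=
    fun n => (hA.isRK n).eq_of_mem (hA.pathElt_mem γ n) (hA.pathElt_mem γ' n) (h n) (h' n)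
  refine Subtype.ext (funext fun n => hA.edge_ext ?_ ?_)
  · rw [rng_eq_src, rng_eq_src]
    exact (key (n + 1)).1
  · have h1 := (key (n + 1)).2
    rw [pathElt_succ, pathElt_succ, (key n).2] at h1
    exact mul_right_cancel h1

theorem exists_address (hA : IsRKSequence A S) (x : X) (n : ℕ) :
    ∃ p : ι n × G, p.2 ∈ (A n).elts p.1 ∧ x ∈ (A n).floor p.1 p.2 := by
  obtain ⟨v, g, hg, hx⟩ := (hA.isRK n).cover x
  exact ⟨(v, g), hg, hx⟩

/-- Refinement factors the finer address through some coarse floor containing `x`; disjointness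
identifies it with the given one. -/
theorem exists_edge (hA : IsRKSequence A S) {x : X} {n : ℕ} {p : ι n × G} {q : ι (n + 1) × G}
    (hp : p.2 ∈ (A n).elts p.1) (hxp : x ∈ (A n).floor p.1 p.2)
    (hq : q.2 ∈ (A (n + 1)).elts q.1) (hxq : x ∈ (A (n + 1)).floor q.1 q.2) :
    ∃ e : RKEdge (A n) (A (n + 1)), e.src = p.1 ∧ e.rng = q.1 ∧ q.2 = e.elt * p.2 := by
  obtain ⟨u, g, hg, h, hh, hsub, e⟩ := (hA.refines n q.1 q.2).mp hq
  have hx : x ∈ (A n).floor u g := by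
    rw [e, RKSet.floor_mul] at hxq
    obtain ⟨y, hy, rfl⟩ := hxq
    exact ⟨y, hsub hy, rfl⟩
  obtain ⟨h1, h2⟩ := (hA.isRK n).eq_of_mem hg hp hx hxp
  exact ⟨⟨u, q.1, h, hh, hsub⟩, h1, rfl, by rw [e, h2]⟩

theorem exists_path (hA : IsRKSequence A S) (x : X) :
    ∃ γ : (rkDiagram A).Path, ∀ n, x ∈ cell γ n := by
  choose p hp hx using hA.exists_address x
  choose e he1 he2 he3 using fun n => hA.exists_edge (hp n) (hx n) (hp (n + 1)) (hx (n + 1))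
  let γ : (rkDiagram A).Path := ⟨e, fun n => (he2 n).trans (he1 (n + 1)).symm⟩
  have hγ : ∀ n, pathElt γ n = (p n).2 := by
    intro n
    induction n with
    | zero => exact (hA.elts_zero _ _ (hp 0)).symm
    | succ n ih => rw [pathElt_succ, ih, he3 n]
  refine ⟨γ, fun n => ?_⟩
  unfold cell
  rw [hγ]
  have : RKEdge.src (γ.1 n) = (p n).1 := he1 n
  rw [this]
  exact hx n

/-- The path that encodes a point. -/
noncomputable def toPath (hA : IsRKSequence A S) (x : X) : (rkDiagram A).Path :=
  (hA.exists_path x).choose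

theorem mem_cell_toPath (hA : IsRKSequence A S) (x : X) (n : ℕ) : x ∈ cell (hA.toPath x) n :=
  (hA.exists_path x).choose_spec n

theorem toPath_eq (hA : IsRKSequence A S) {γ : (rkDiagram A).Path} {x : X}
    (h : ∀ n, x ∈ cell γ n) : hA.toPath x = γ :=
  hA.path_eq_of_mem_cell (hA.mem_cell_toPath x) h

theorem src_eq_and_pathElt_eq (hA : IsRKSequence A S) {x : X} {n : ℕ} {v : ι n} {g : G}
    (hg : g ∈ (A n).elts v) (hx : x ∈ (A n).floor v g) :
    RKEdge.src ((hA.toPath x).1 n) = v ∧ pathElt (hA.toPath x) n = g :=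
  (hA.isRK n).eq_of_mem (hA.pathElt_mem _ n) hg (hA.mem_cell_toPath x n) hx

theorem toPath_injective (hA : IsRKSequence A S) : Function.Injective hA.toPath := by
  intro x y h
  refine hA.eq_of_mem_cell (hA.mem_cell_toPath x) fun n => ?_
  rw [h]
  exact hA.mem_cell_toPath y n

theorem toPath_surjective [CompactSpace X] (hA : IsRKSequence A S) :
    Function.Surjective hA.toPath := by
  intro γ
  obtain ⟨x, hx⟩ := hA.exists_mem_cell γ
  exact ⟨x, hA.toPath_eq hx⟩

/-- Edge `n` of the path is constant on the open cell of level `n + 1`. -/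
theorem continuous_toPath (hA : IsRKSequence A S) : Continuous hA.toPath := by
  let _ : ∀ n, TopologicalSpace ((rkDiagram A).E n) := fun _ => ⊥
  refine continuous_induced_rng.mpr (continuous_pi fun n => ?_)
  refine (IsLocallyConstant.iff_exists_open _).mpr (fun x => ?_) |>.continuous
  refine ⟨cell (hA.toPath x) (n + 1), ((hA.isRK _).clopen _ _ (hA.pathElt_mem _ _)).2,
    hA.mem_cell_toPath x _, fun y hy => ?_⟩
  obtain ⟨h1, h2⟩ := hA.src_eq_and_pathElt_eq (hA.pathElt_mem _ (n + 1)) hy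
  obtain ⟨h3, h4⟩ := hA.src_eq_and_pathElt_eq (hA.pathElt_mem _ n) (cell_succ_subset _ _ hy)
  refine hA.edge_ext ?_ ?_
  · exact (rng_eq_src _ _).trans (h1.trans (rng_eq_src _ _).symm)
  · rw [pathElt_succ, pathElt_succ, h4] at h2
    exact mul_right_cancel h2

/-- If a generator does not leave the tower, then it moves only the beginning of a path. -/
theorem toPath_smul (hA : IsRKSequence A S) {x : X} {s : G} {n : ℕ}
    (hs : pathElt (hA.toPath x) n * s ∈ (A n).elts (RKEdge.src ((hA.toPath x).1 n))) :
    (∀ m, n ≤ m → (hA.toPath x).1 m = (hA.toPath (op s • x)).1 m) ∧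
      pathElt (hA.toPath (op s • x)) n = pathElt (hA.toPath x) n * s := by
  -- Once the generator stays inside the tower at level `n`, refinement keeps it inside at every
  -- later level.
  have hmem : ∀ m, n ≤ m →
      pathElt (hA.toPath x) m * s ∈ (A m).elts (RKEdge.src ((hA.toPath x).1 m)) := by
    intro m hm
    induction m, hm using Nat.le_induction with
    | base => exact hs
    | succ m hm ih =>
      rw [← rng_eq_src, pathElt_succ, mul_assoc]
      exact (hA.refines m _ _).mpr
        ⟨_, _, ih, _, RKEdge.mem ((hA.toPath x).1 m), RKEdge.sub ((hA.toPath x).1 m), rfl⟩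
  have key : ∀ m, n ≤ m →
      RKEdge.src ((hA.toPath (op s • x)).1 m) = RKEdge.src ((hA.toPath x).1 m) ∧
      pathElt (hA.toPath (op s • x)) m = pathElt (hA.toPath x) m * s := by
    intro m hm
    refine hA.src_eq_and_pathElt_eq (hmem m hm) ?_
    rw [RKSet.floor_mul]
    exact ⟨x, hA.mem_cell_toPath x m, rfl⟩
  refine ⟨fun m hm => ?_, (key n le_rfl).2⟩
  refine hA.edge_ext ?_ ?_
  · rw [rng_eq_src, rng_eq_src, (key (m + 1) (by omega)).1]
  · have h1 := (key (m + 1) (by omega)).2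
    rw [pathElt_succ, pathElt_succ, (key m hm).2, mul_assoc] at h1
    exact (mul_right_cancel h1).symm

end IsRKSequence

instance : T2Space (rkDiagram A).Path := by
  let _ : ∀ n, TopologicalSpace ((rkDiagram A).E n) := fun _ => ⊥
  have : ∀ n, DiscreteTopology ((rkDiagram A).E n) := fun _ => ⟨rfl⟩
  exact T2Space.of_injective_continuous Subtype.val_injective continuous_induced_dom

namespace IsRKSequence

/-- The coding of the points by paths. -/
noncomputable def coding [CompactSpace X] (hA : IsRKSequence A S) : X ≃ₜ (rkDiagram A).Path :=
  Continuous.homeoOfEquivCompactToT2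
    (f := Equiv.ofBijective hA.toPath ⟨hA.toPath_injective, hA.toPath_surjective⟩)
    hA.continuous_toPath

theorem coding_apply [CompactSpace X] (hA : IsRKSequence A S) (x : X) :
    hA.coding x = hA.toPath x := rfl

theorem coding_symm_mem_cell [CompactSpace X] (hA : IsRKSequence A S) (γ : (rkDiagram A).Path)
    (n : ℕ) : hA.coding.symm γ ∈ cell γ n := by
  have := hA.mem_cell_toPath (hA.coding.symm γ) n
  rwa [← coding_apply, Homeomorph.apply_symm_apply] at this

variable [CompactSpace X]

theorem coding_symm_mem_pathCell (hA : IsRKSequence A S) (γ : (rkDiagram A).Path) (n : ℕ) :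
    hA.coding.symm γ ∈ pathCell γ n := by
  rw [pathCell_eq]
  exact hA.coding_symm_mem_cell γ (n + 1)

theorem exists_cell_subset [T2Space X] (hA : IsRKSequence A S) (x : X) {U : Set X} (hU : U ∈ 𝓝 x) :
    ∃ n, cell (hA.toPath x) n ⊆ U := by
  have hcl : ∀ n, IsClosed (cell (hA.toPath x) n) := fun n =>
    ((hA.isRK n).clopen _ _ (hA.pathElt_mem _ n)).1
  refine exists_subset_nhds_of_isCompact (antitone_cell _).directed_ge
    (fun n => (hcl n).isCompact) fun y hy => ?_
  rw [hA.eq_of_mem_cell (fun n => mem_iInter.mp hy n) (hA.mem_cell_toPath x)]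
  exact hU

theorem dense_of_floor [T2Space X] (hA : IsRKSequence A S) {D : Set X}
    (hD : ∀ n v g, ((A n).floor v g ∩ D).Nonempty) : Dense D := by
  intro x
  rw [mem_closure_iff_nhds]
  intro U hU
  obtain ⟨n, hn⟩ := hA.exists_cell_subset x hU
  exact (hD n _ _).mono (inter_subset_inter_left _ hn)

variable [ContinuousConstSMul Gᵐᵒᵖ X]

/-- The action on the path space that corresponds to the action on the points. -/
noncomputable def pathAction (hA : IsRKSequence A S) :
    Gᵐᵒᵖ →* ((rkDiagram A).Path ≃ₜ (rkDiagram A).Path) where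
  toFun g := (hA.coding.symm.trans (Homeomorph.smul g)).trans hA.coding
  map_one' := by
    ext1 γ
    show hA.coding ((1 : Gᵐᵒᵖ) • hA.coding.symm γ) = γ
    rw [one_smul, Homeomorph.apply_symm_apply]
  map_mul' g h := by
    ext1 γ
    show hA.coding ((g * h) • hA.coding.symm γ) =
      hA.coding (g • hA.coding.symm (hA.coding (h • hA.coding.symm γ)))
    rw [Homeomorph.symm_apply_apply, mul_smul]

theorem pathAction_apply (hA : IsRKSequence A S) (g : Gᵐᵒᵖ) (γ : (rkDiagram A).Path) :
    hA.pathAction g γ = hA.coding (g • hA.coding.symm γ) := rfl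

theorem coding_symm_pathAction (hA : IsRKSequence A S) (g : Gᵐᵒᵖ) (γ : (rkDiagram A).Path) :
    hA.coding.symm (hA.pathAction g γ) = g • hA.coding.symm γ :=
  hA.coding.symm_apply_apply _

theorem isNaturalAction_pathAction (hA : IsRKSequence A S) :
    IsNaturalAction A hA.pathAction := by
  intro γ γ' n h
  rw [pathAction_apply, coding_apply]
  refine hA.toPath_eq fun m => ?_
  -- Cells decrease, so the level may be raised past `n`, where both paths pass through the same
  -- vertex.
  refine antitone_cell γ' (le_max_left m n) ?_
  have hx := hA.coding_symm_mem_cell γ (max m n)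
  unfold cell at hx ⊢
  rw [← pathElt_inv_mul_const h (le_max_right m n), ← h _ (le_max_right m n)]
  obtain ⟨y, hy, e⟩ := hx
  refine ⟨y, hy, ?_⟩
  simp only at e ⊢
  rw [← e, smul_smul, ← op_mul, mul_inv_cancel_left]

/-- The natural action is unique if there is a dense set of points whose encoding is changed by
each generator only at its beginning. -/
theorem eq_pathAction [T2Space X] (hA : IsRKSequence A S) (hS : Subgroup.closure S = ⊤) {D : Set X}
    (hD : ∀ n v g, ((A n).floor v g ∩ D).Nonempty)
    (hexit : ∀ x ∈ D, ∀ s ∈ S, ∃ n, ∀ v, ∀ g ∈ (A n).elts v, x ∈ (A n).floor v g →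
      g * s ∈ (A n).elts v)
    {ρ : Gᵐᵒᵖ →* ((rkDiagram A).Path ≃ₜ (rkDiagram A).Path)} (hρ : IsNaturalAction A ρ) :
    ρ = hA.pathAction := by
  have hgen : ∀ s ∈ S, ρ (op s) = hA.pathAction (op s) := by
    intro s hs
    have hdense : Dense (hA.coding '' D) :=
      hA.coding.surjective.denseRange.dense_image hA.coding.continuous (hA.dense_of_floor hD)
    refine DFunLike.coe_injective (Continuous.ext_on hdense (ρ (op s)).continuous
      (hA.pathAction (op s)).continuous ?_)
    rintro _ ⟨x, hx, rfl⟩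
    obtain ⟨n, hn⟩ := hexit x hx s hs
    obtain ⟨h1, h2⟩ := hA.toPath_smul (x := x) (s := s) (n := n)
      (hn _ _ (hA.pathElt_mem _ n) (hA.mem_cell_toPath x n))
    -- Here the element prescribed by naturality is `g⁻¹(gs) = s`.
    have h3 := hρ _ _ n h1
    rw [h2, inv_mul_cancel_left] at h3
    rw [pathAction_apply, Homeomorph.symm_apply_apply]
    exact h3
  have hcl : ∀ g : G, ρ (op g) = hA.pathAction (op g) := by
    intro g
    have hg : g ∈ Subgroup.closure S := by rw [hS]; trivial
    induction hg using Subgroup.closure_induction with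
    | mem s hs => exact hgen s hs
    | one => rw [op_one, map_one, map_one]
    | mul x y _ _ hx hy => rw [op_mul, map_mul, map_mul, hx, hy]
    | inv x _ hx => rw [op_inv, map_inv, map_inv, hx]
  exact MonoidHom.ext fun g => hcl (unop g)

end IsRKSequence

end PathSpace

/-! ### Continued fractions -/

theorem finCF_mem_Icc (n : ℕ) : ∀ c : ℕ → ℕ, (∀ k, 0 < c k) → finCF c n ∈ Icc (0 : ℝ) 1 := by
  induction n with
  | zero => intro c _; exact ⟨le_rfl, zero_le_one⟩
  | succ n ih =>
    intro c hc
    obtain ⟨h0, -⟩ := ih (fun k => c (k + 1)) fun k => hc (k + 1)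
    have h1 : (1 : ℝ) ≤ c 0 := by exact_mod_cast hc 0
    show 1 / ((c 0 : ℝ) + finCF (fun k => c (k + 1)) n) ∈ Icc (0 : ℝ) 1
    refine ⟨by positivity, ?_⟩
    rw [div_le_one (by linarith)]
    linarith

/-- Inverting and subtracting `c 0` turns the convergents into those of the shifted sequence. Their
limit lies in `[0, 1]`, and irrationality excludes `1`, so `c 0` is the integer part of `1/θ`. -/
theorem cfDigit_eq_of_tendsto {θ : IrrUnit} {c : ℕ → ℕ} (hc : ∀ n, 0 < c n)
    (h : Tendsto (finCF c) atTop (𝓝 θ.1)) :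
    cfDigit θ = c 0 ∧ Tendsto (finCF fun k => c (k + 1)) atTop (𝓝 (gauss θ).1) := by
  have h0 := θ.2.2.1
  have h1 : Tendsto (fun n => (finCF c (n + 1))⁻¹ - c 0) atTop (𝓝 (θ.1⁻¹ - c 0)) :=
    ((h.comp (tendsto_add_atTop_nat 1)).inv₀ h0.ne').sub_const _
  have h2 : (fun n => (finCF c (n + 1))⁻¹ - c 0) = finCF fun k => c (k + 1) := by
    ext n
    show (1 / ((c 0 : ℝ) + finCF (fun k => c (k + 1)) n))⁻¹ - c 0 = _
    rw [one_div, inv_inv, add_sub_cancel_left]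
  rw [h2] at h1
  have h3 : θ.1⁻¹ - c 0 ∈ Icc (0 : ℝ) 1 :=
    isClosed_Icc.mem_of_tendsto h1
      (Eventually.of_forall fun n => finCF_mem_Icc n _ fun k => hc (k + 1))
  have h4 : θ.1⁻¹ - c 0 ≠ 1 := by
    intro e
    refine θ.2.1.inv.ne_nat (c 0 + 1) ?_
    push_cast
    linarith
  have h5 : cfDigit θ = c 0 := by
    unfold cfDigit
    rw [Nat.floor_eq_iff (by positivity), one_div]
    have := lt_of_le_of_ne h3.2 h4
    exact ⟨by linarith [h3.1], by linarith⟩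
  refine ⟨h5, ?_⟩
  have : (gauss θ).1 = θ.1⁻¹ - c 0 := by
    show 1 / θ.1 - (cfDigit θ : ℝ) = _
    rw [h5, one_div]
  rwa [this]

theorem cfDigit_iterate_gauss (n : ℕ) : ∀ {θ : IrrUnit} {c : ℕ → ℕ}, (∀ n, 0 < c n) →
    Tendsto (finCF c) atTop (𝓝 θ.1) → cfDigit (gauss^[n] θ) = c n := by
  induction n with
  | zero => intro θ c hc h; exact (cfDigit_eq_of_tendsto hc h).1
  | succ n ih =>
    intro θ c hc h
    exact ih (fun k => hc (k + 1)) (cfDigit_eq_of_tendsto hc h).2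

theorem lt_half_iff (θ : IrrUnit) :
    (θ.1 < 1 / 2 ↔ 2 ≤ cfDigit θ) ∧ (1 / 2 < θ.1 ↔ cfDigit θ = 1) := by
  have h0 := θ.2.2.1
  have hne : θ.1 ≠ 1 / 2 := by
    intro e
    apply θ.2.1
    exact ⟨1 / 2, by rw [e]; norm_num⟩
  have h1 : 2 ≤ cfDigit θ ↔ θ.1 ≤ 1 / 2 := by
    unfold cfDigit
    rw [Nat.le_floor_iff (by positivity), le_div_iff₀ h0]
    push_cast
    constructor <;> intro h <;> linarith
  have hp := cfDigit_pos θ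
  refine ⟨?_, ?_⟩
  · rw [h1, le_iff_lt_or_eq]
    tauto
  · have : cfDigit θ = 1 ↔ ¬ 2 ≤ cfDigit θ := by omega
    rw [this, h1, not_le]

/-! ### The sequence of the dihedral action -/

/-- A generator moves each cut point along its tower, if the tower is high enough. -/
theorem eventually_mul_mem_elts {θ : IrrUnit} {x : CutCircle θ} (hx : x.side ≠ 0) {s : DInf}
    (hs : s ∈ ({genA, genB} : Set DInf)) :
    ∀ᶠ n in atTop, ∀ v, ∀ g ∈ (dihedralRK n θ).elts v, x ∈ (dihedralRK n θ).floor v g →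
      g * s ∈ (dihedralRK n θ).elts v := by
  have hpos : 0 < |(op s • x).pos - x.pos| := abs_pos.mpr (sub_ne_zero.mpr (smul_pos_ne hx hs))
  filter_upwards [(tendsto_thetaProd θ).eventually_lt_const hpos] with n hn v g hg hxg
  rcases (isGood n θ).exit v g hg s hs with h | h
  · exact h
  · exact absurd (h x hxg) (not_le.mpr hn)

/-- Two points lie in the same element of a tower of each `𝒜_n`. -/
def SameFloors (θ : IrrUnit) (x y : CutCircle θ) : Prop :=
  ∀ n, ∃ v, ∃ g ∈ (dihedralRK n θ).elts v,
    x ∈ (dihedralRK n θ).floor v g ∧ y ∈ (dihedralRK n θ).floor v g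

theorem exists_floor_of_le {θ : IrrUnit} {x y : CutCircle θ} {m n : ℕ} (hmn : m ≤ n)
    (h : ∃ v, ∃ g ∈ (dihedralRK n θ).elts v,
      x ∈ (dihedralRK n θ).floor v g ∧ y ∈ (dihedralRK n θ).floor v g) :
    ∃ v, ∃ g ∈ (dihedralRK m θ).elts v,
      x ∈ (dihedralRK m θ).floor v g ∧ y ∈ (dihedralRK m θ).floor v g := by
  induction n, hmn using Nat.le_induction with
  | base => exact h
  | succ n _ ih =>
    apply ih
    obtain ⟨v, k, hk, hx, hy⟩ := h
    obtain ⟨u, g, hg, h, -, hsub, rfl⟩ := (refines n θ v k).mp hk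
    rw [RKSet.floor_mul] at hx hy
    obtain ⟨x', hx', rfl⟩ := hx
    obtain ⟨y', hy', rfl⟩ := hy
    exact ⟨u, g, hg, ⟨x', hsub hx', rfl⟩, ⟨y', hsub hy', rfl⟩⟩

/-! ### Separation of points -/

namespace SameFloors

variable {θ : IrrUnit} {x y : CutCircle θ}

theorem pos_eq (h : SameFloors θ x y) : x.pos = y.pos := by
  have h1 : |x.pos - y.pos| ≤ 0 := by
    refine ge_of_tendsto' (tendsto_thetaProd θ) fun n => ?_
    obtain ⟨v, g, hg, hx, hy⟩ := h n
    exact (isGood n θ).diam v g hg x hx y hy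
  exact sub_eq_zero.mp (abs_eq_zero.mp (le_antisymm h1 (abs_nonneg _)))

/-- At high levels the generator keeps the floor of the cut point `x` in its tower, and `y` moves
along with that floor. Lower levels follow by refinement. -/
theorem smul (h : SameFloors θ x y) (hx : x.side ≠ 0) {s : DInf}
    (hs : s ∈ ({genA, genB} : Set DInf)) : SameFloors θ (op s • x) (op s • y) := by
  intro m
  obtain ⟨n, hn, hmn⟩ := ((eventually_mul_mem_elts hx hs).and (eventually_ge_atTop m)).exists
  refine exists_floor_of_le hmn ?_
  obtain ⟨v, g, hg, hxg, hyg⟩ := h n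
  refine ⟨v, g * s, hn v g hg hxg, ?_⟩
  rw [RKSet.floor_mul]
  exact ⟨⟨x, hxg, rfl⟩, ⟨y, hyg, rfl⟩⟩

theorem smul_all (h : SameFloors θ x y) (hx : x.side ≠ 0) (g : DInf) :
    SameFloors θ (op g • x) (op g • y) := by
  have hg : g ∈ Subgroup.closure ({genA, genB} : Set DInf) := by
    rw [closure_genA_genB]; trivial
  induction hg using Subgroup.closure_induction_right with
  | one => rwa [op_one_smul, op_one_smul]
  | mul_right g _ s hs ih =>
    rw [smul_mul, smul_mul]
    exact ih.smul (fun h' => hx ((smul_side_eq_zero g x).mp h')) hs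
  | mul_inv_cancel g _ s hs ih =>
    have : s⁻¹ = s := by rcases hs with rfl | rfl <;> rfl
    rw [this, smul_mul, smul_mul]
    exact ih.smul (fun h' => hx ((smul_side_eq_zero g x).mp h')) hs

/-- Equal positions suffice off the cuts. A cut point is first moved to an end of `[0, 1]`, where
only one side exists. -/
theorem eq (h : SameFloors θ x y) : x = y := by
  by_cases hx : x.side = 0
  · refine ext' h.pos_eq ?_
    rw [hx, eq_comm, y.side_eq_zero, ← h.pos_eq, ← x.side_eq_zero, hx]
  · obtain ⟨g, hg⟩ := exists_smul_pos_eq hx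
    have hp := (h.smul_all hx g).pos_eq
    have e : op g • x = op g • y := by
      refine ext' hp ?_
      rcases hg with hg | hg
      · rw [side_of_pos_zero _ hg, side_of_pos_zero _ (hp ▸ hg)]
      · rw [side_of_pos_one _ hg, side_of_pos_one _ (hp ▸ hg)]
    exact MulAction.injective (op g) e

end SameFloors

theorem isRKSequence_dihedralRK (θ : IrrUnit) :
    IsRKSequence (fun n => dihedralRK n θ) ({genA, genB} : Set DInf) where
  isRK n := (isGood n θ).isRK
  refines n := refines n θ
  elts_zero _ _ hg := hg
  separates _ _ h := SameFloors.eq h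

theorem isBratteli_dihedralDiagram (θ : IrrUnit) : (dihedralDiagram θ).IsBratteli where
  finite_V _ := inferInstanceAs (Finite (Fin 2))
  finite_E n := by
    have := fun v => ((isGood (n + 1) θ).isRK.finite v).to_subtype
    refine Finite.of_injective
      (fun e : RKEdge (dihedralRK n θ) (dihedralRK (n + 1) θ) =>
        ((⟨e.rng, e.elt, e.mem⟩ : Σ v, (dihedralRK (n + 1) θ).elts v))) ?_
    intro e e' h
    have h1 : e.rng = e'.rng := congrArg Sigma.fst h
    have h2 : e.elt = e'.elt :=
      congrArg (fun p : Σ v, (dihedralRK (n + 1) θ).elts v => (p.2 : DInf)) h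
    exact (isRKSequence_dihedralRK θ).edge_ext h1 h2
  src_surjective n u := by
    -- The range `0` is used because there may be no edge from `1` to `1`.
    have h : 0 < (dihedralDiagram θ).mult n u (0 : Fin 2) := by
      refine lt_of_lt_of_eq ?_ (mult_eq n θ u 0).symm
      split_ifs
      · exact one_pos
      · simp only [rkHeight, if_true, add_tsub_cancel_right]
        exact cfDigit_pos _
    obtain ⟨⟨e, he, -⟩⟩ := (Nat.card_pos_iff.mp h).1
    exact ⟨e, he⟩
  rng_surjective n v := by
    have h : 0 < (dihedralDiagram θ).mult n (0 : Fin 2) v := by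
      refine lt_of_lt_of_eq ?_ (mult_eq n θ 0 v).symm
      rw [if_pos rfl]
      exact one_pos
    obtain ⟨⟨e, -, he⟩⟩ := (Nat.card_pos_iff.mp h).1
    exact ⟨e, he⟩

theorem mainTheorem8 (θ : IrrUnit) (c : ℕ → ℕ) (hc : ∀ n, 0 < c n)
    (hcf : Tendsto (finCF c) atTop (𝓝 θ.1)) :
    -- the sets form a refining sequence of Rokhlin-Kakutani sets
    (∀ n, (dihedralRK n θ).IsRK {genA, genB} ∧
      (dihedralRK n θ).Refines (dihedralRK (n + 1) θ)) ∧
    -- description of the diagram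
    (dihedralDiagram θ).IsBratteli ∧
    (∀ n, (thetaSeq θ n < 1 / 2 ↔ 2 ≤ c n) ∧ (1 / 2 < thetaSeq θ n ↔ c n = 1)) ∧
    (∀ n, 2 ≤ c n →
      (dihedralDiagram θ).mult n (0 : Fin 2) (0 : Fin 2) = 1 ∧
      (dihedralDiagram θ).mult n (0 : Fin 2) (1 : Fin 2) = 1 ∧
      (dihedralDiagram θ).mult n (1 : Fin 2) (0 : Fin 2) = c n ∧
      (dihedralDiagram θ).mult n (1 : Fin 2) (1 : Fin 2) = c n - 1) ∧
    (∀ n, c n = 1 →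
      (dihedralDiagram θ).mult n (0 : Fin 2) (0 : Fin 2) = 1 ∧
      (dihedralDiagram θ).mult n (0 : Fin 2) (1 : Fin 2) = 1 ∧
      (dihedralDiagram θ).mult n (1 : Fin 2) (0 : Fin 2) = 1 ∧
      (dihedralDiagram θ).mult n (1 : Fin 2) (1 : Fin 2) = 0) ∧
    -- the natural action on the path space and its conjugacy with the action on the Cantor set
    (∃! ρ : DInfᵐᵒᵖ →* ((dihedralDiagram θ).Path ≃ₜ (dihedralDiagram θ).Path),
      IsNaturalAction (fun n => dihedralRK n θ) ρ) ∧
    (∀ ρ : DInfᵐᵒᵖ →* ((dihedralDiagram θ).Path ≃ₜ (dihedralDiagram θ).Path),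
      IsNaturalAction (fun n => dihedralRK n θ) ρ →
      ∃ Φ : (dihedralDiagram θ).Path ≃ₜ CutCircle θ,
        (∀ (g : DInf) (γ : (dihedralDiagram θ).Path), Φ (ρ (op g) γ) = op g • Φ γ) ∧
        ∀ (γ : (dihedralDiagram θ).Path) (n : ℕ),
          Φ γ ∈ pathCell (A := fun n => dihedralRK n θ) γ n) := by
  have hseq := isRKSequence_dihedralRK θ
  have hdig : ∀ n, cfDigit (gauss^[n] θ) = c n := fun n => cfDigit_iterate_gauss n hc hcf
  have huniq : ∀ ρ : DInfᵐᵒᵖ →* ((dihedralDiagram θ).Path ≃ₜ (dihedralDiagram θ).Path),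
      IsNaturalAction (fun n => dihedralRK n θ) ρ → ρ = hseq.pathAction := by
    intro ρ hρ
    -- The cut points meet every floor, and each generator eventually keeps a given cut point inside
    -- its tower.
    exact hseq.eq_pathAction closure_genA_genB (D := {x | x.side ≠ 0})
      (fun n v g => exists_cut_mem_floor n θ v g)
      (fun x hx s hs => (eventually_mul_mem_elts hx hs).exists) hρ
  refine ⟨fun n => ⟨(isGood n θ).isRK, refines n θ⟩, isBratteli_dihedralDiagram θ, fun n => ?_,
    fun n _ => ?_, fun n hn => ?_, ⟨hseq.pathAction, hseq.isNaturalAction_pathAction, huniq⟩,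
    fun ρ hρ => ?_⟩
  · rw [← hdig n]
    exact lt_half_iff (gauss^[n] θ)
  · simp only [mult_eq, rkHeight, hdig, if_true, one_ne_zero, if_false, add_tsub_cancel_right,
      and_self]
  · simp only [mult_eq, rkHeight, hdig, hn, if_true, one_ne_zero, if_false, add_tsub_cancel_right,
      tsub_self, and_self]
  · rw [huniq ρ hρ]
    exact ⟨hseq.coding.symm, fun g γ => hseq.coding_symm_pathAction (op g) γ,
      hseq.coding_symm_mem_pathCell⟩
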